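/- **The elastic Lateral-as-Window (LaW) 2D queue.** There are $N$ FIFO *sub-queues* (Michael–Scott queues with atomic, failable enqueue and dequeue), numbered $0,\dots,N-1$. Each item in a sub-queue is stored with a *row* number; an initial dummy has row $0$. A *window* $W$ has a maximum $W.\mathrm{max}$, a depth $W.\mathrm{depth}\ge 1$ and a width $1\le W.\mathrm{width}\le N$; it spans the rows $W.\mathrm{max}-W.\mathrm{depth}+1,\dots,W.\mathrm{max}$ of the sub-queues $0,\dots,W.\mathrm{width}-1$. The *Lateral* is a Michael–Scott queue of windows; its head and tail nodes are the head window $W^{head}$ and the tail window $W^{tail}$. Initially the sub-queues are empty and the Lateral holds one window with $\mathrm{max}=\mathrm{depth}$. Two shared variables, the desired depth (positive) and the desired width (between $1$ and $N$), may be changed at any time. Threads execute concurrently, interleaving atomic accesses to the shared memory. *Enqueue of $x$:* read $W=W^{tail}$ and search the sub-queues of $W$. If one has a last row $r<W.\mathrm{max}$, try to append $x$ to it at row $\max(W.\mathrm{max}-W.\mathrm{depth},\,r)+1$, which fails, and causes a restart, if its last node has changed in the meantime. If all were seen at a last row $\ge W.\mathrm{max}$, read the shared depth $d$ and the shared width $v$,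 try to enqueue the window with maximum $W.\mathrm{max}+d$, depth $d$, width $v$ directly after $W$ in the Lateral, and restart. *Dequeue:* read $W=W^{head}$ and search the sub-queues of $W$. If one has a first item of row $\le W.\mathrm{max}$, try to dequeue it, which fails, and causes a restart, if the head of that sub-queue has changed in the meantime. If for all of them the last dequeued row was seen to be $\ge W.\mathrm{max}$, try to dequeue $W$ from the Lateral (which fails if $W$ is not the head or has no successor) and restart. If none was seen with an item in $W$, and $W$ has no successor in the Lateral, collect the sub-queues of $W$ a second time, and return *empty* if all of them are empty and unchanged. Searches may visit the sub-queues in any order and may be restarted at any time. **Theorem.** The elastic LaW 2D queue is linearizable with respect to a FIFO queue with elastic $k$ out-of-order relaxed dequeues, where $k=(W^{head}.\mathrm{width}-1)\cdot W^{head}.\mathrm{depth}$. That is: for every finite execution, with any number of threads and any changes of the desired depth and width, there is a linearization of its history (a sequential order of all completed and some of the pending operations that respects the real-time order and all return values) in which, starting from an empty queue, every enqueue appends its item at the end of the queue; every dequeue that returns an item returns and removes one of the first $k+1$ items of the queue, where $k=(W^{head}.\mathrm{width}-1)\cdot W^{head}.\mathrm{depth}$ for the head window $W^{head}$ at the moment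 when this dequeue removes the item from its sub-queue; and a dequeue returns *empty* only when the queue is empty. Moreover, this window is the one the item lives in: it was the tail window at the moment when the item was enqueued on its sub-queue. -/

import Mathlib

namespace ElasticLaW

/-! ## Histories, linearizations and the elastically relaxed FIFO queue -/

/-- Operations of a queue with items in `α`. -/
inductive Op (α : Type*) where
  | enq (x : α)
  | deq

/-- Return values: `ack` for an enqueue, `item x` / `empty` for a dequeue. -/
inductive Ret (α : Type*) where
  | ack
  | item (x : α)
  | empty

/-- Events of a concurrent history. Operation instances carry unique identifiers. -/
inductive Event (α : Type*) where
  | inv (o : ℕ) (op : Op α)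
  | res (o : ℕ) (r : Ret α)

/-- A completed operation instance, as it occurs in a sequential history. -/
structure Call (α : Type*) where
  id : ℕ
  op : Op α
  ret : Ret α

/-- Real-time order: the response of `o₁` occurs in `H` before the invocation of `o₂`. -/
def Precedes {α : Type*} (H : List (Event α)) (o₁ o₂ : ℕ) : Prop :=
  ∃ (m n : ℕ) (r : Ret α) (op : Op α),
    m < n ∧ H[m]? = some (Event.res o₁ r) ∧ H[n]? = some (Event.inv o₂ op)

/-- The sequential history `S` is a linearization of the concurrent history `H`: it consists of
all operations that have returned in `H`, with their return values, and of some of the pending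
ones, completed by a return value, each exactly once, in an order that extends the real-time order.
(A thread runs one operation at a time, so its program order is part of the real-time order.) -/
structure IsLinearization {α : Type*} (H : List (Event α)) (S : List (Call α)) : Prop where
  nodup : (S.map Call.id).Nodup
  invoked : ∀ c ∈ S, Event.inv c.id c.op ∈ H
  complete : ∀ (o : ℕ) (r : Ret α), Event.res o r ∈ H → ∃ c ∈ S, c.id = o ∧ c.ret = r
  realTime : S.Pairwise fun c c' => ¬ Precedes H c'.id c.id

/-- Sequential specification of the FIFO queue with elastic out-of-order relaxed dequeues,
started with contents `q` (oldest item first). The non-empty dequeue with identifier `o` may return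
any of the first `k o + 1` items, i.e. its rank error is at most `k o`. A dequeue
returns `empty` only if the queue is empty. -/
inductive RelaxedFIFO {α : Type*} (k : ℕ → ℕ) : List α → List (Call α) → Prop where
  | nil (q : List α) : RelaxedFIFO k q []
  | enq (q : List α) (o : ℕ) (x : α) (S : List (Call α)) :
      RelaxedFIFO k (q ++ [x]) S → RelaxedFIFO k q (⟨o, Op.enq x, Ret.ack⟩ :: S)
  | deq (q : List α) (o : ℕ) (x : α) (rank : ℕ) (S : List (Call α)) :
      q[rank]? = some x → rank ≤ k o →
      RelaxedFIFO k (q.eraseIdx rank) S → RelaxedFIFO k q (⟨o, Op.deq, Ret.item x⟩ :: S)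
  | deqEmpty (o : ℕ) (S : List (Call α)) :
      RelaxedFIFO k [] S → RelaxedFIFO k [] (⟨o, Op.deq, Ret.empty⟩ :: S)

/-- The history `H` is linearizable with respect to an initially empty FIFO queue whose
dequeue `o` is relaxed `k o` out of order. -/
def Linearizable {α : Type*} (H : List (Event α)) (k : ℕ → ℕ) : Prop :=
  ∃ S : List (Call α), IsLinearization H S ∧ RelaxedFIFO k [] S

/-! ## Michael-Scott queues with failable operations -/

/-- A Michael-Scott queue. `nodes` lists all nodes ever linked, in linking order, and a node
pointer is a position in it; nodes are immutable and pointers are never reused. `head` points to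
the current dummy node, the last entry is the tail, and the node after the dummy is the first one in
the queue. -/
structure MSQueue (β : Type*) where
  nodes : List β
  head : ℕ

/-- `p` points to the tail, i.e. `p` has no successor. -/
def MSQueue.IsTail {β : Type*} (q : MSQueue β) (p : ℕ) : Prop := p + 1 = q.nodes.length

/-- Try to atomically enqueue `b` directly after `expected`. -/
def MSQueue.enqueue? {β : Type*} (q : MSQueue β) (expected : ℕ) (b : β) : Option (MSQueue β) :=
  if expected + 1 = q.nodes.length then some ⟨q.nodes ++ [b], q.head⟩ else none

/-- Try to atomically dequeue if `expected` is the head: the head pointer moves to its successor,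
provided there is one. -/
def MSQueue.dequeue? {β : Type*} (q : MSQueue β) (expected : ℕ) : Option (MSQueue β) :=
  if q.head = expected ∧ expected + 1 < q.nodes.length then some ⟨q.nodes, expected + 1⟩ else none

/-! ## Shared and local state of the Lateral-as-Window queue -/

/-- A window; it spans the rows `max - depth + 1, …, max` of the sub-queues `0, …, width - 1`. -/
structure Window where
  max : ℕ
  depth : ℕ
  width : ℕ

/-- A sub-queue node: an item and its row (the initial dummy has row `0` and no item). -/
structure Node (α : Type*) where
  item : Option α
  row : ℕ

/-- Shared memory. `N` is the number of sub-queues allocated at initialization. The head and tail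
windows are the head and tail nodes of the Lateral. `nextOp` is only used to name operations. -/
structure Shared (α : Type*) (N : ℕ) where
  sub : Fin N → MSQueue (Node α)
  lateral : MSQueue Window
  depthShared : ℕ
  widthShared : ℕ
  nextOp : ℕ

/-- The current head window is `W`. -/
def Shared.HeadWindow {α : Type*} {N : ℕ} (g : Shared α N) (W : Window) : Prop :=
  g.lateral.nodes[g.lateral.head]? = some W

/-- The current tail window is `W`. -/
def Shared.TailWindow {α : Type*} {N : ℕ} (g : Shared α N) (W : Window) : Prop :=
  g.lateral.nodes.getLast? = some W

/-- Local state of a thread. `o` is the running operation, `x` the item to be enqueued, `w` points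
to the Lateral node (window) the thread works in. -/
inductive Pc (α : Type*) (N : ℕ) where
  | idle
  /-- About to read the tail window. -/
  | enqStart (o : ℕ) (x : α)
  /-- Searching for a sub-queue that is not full; those in `full` were seen at `max`. -/
  | enqSearch (o : ℕ) (x : α) (w : ℕ) (full : Finset (Fin N))
  /-- About to try to enqueue on sub-queue `j` at row `row` after the node `last`. -/
  | enqTry (o : ℕ) (x : α) (w : ℕ) (j : Fin N) (last row : ℕ)
  /-- `ShiftTail`: about to read the shared depth, -/
  | shiftTail (o : ℕ) (x : α) (w : ℕ)
  /-- then to read the shared width, -/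
  | shiftTailWidth (o : ℕ) (x : α) (w depth : ℕ)
  /-- then to try to enqueue the new window after `w`. -/
  | shiftTailTry (o : ℕ) (x : α) (w : ℕ) (new : Window)
  /-- About to read the head window. -/
  | deqStart (o : ℕ)
  /-- Searching for a sub-queue with an item in the window. `obs j = some (h, r)`: sub-queue `j` was
  seen without one, its dummy node being `h`, of row `r`. -/
  | deqSearch (o : ℕ) (w : ℕ) (obs : Fin N → Option (ℕ × ℕ))
  /-- About to try to dequeue the successor of the dummy node `h` from sub-queue `j`. -/
  | deqTry (o : ℕ) (w : ℕ) (j : Fin N) (h : ℕ)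
  /-- `ShiftHead`: about to try to dequeue the window `w` from the Lateral. -/
  | shiftHead (o : ℕ) (w : ℕ)
  /-- Second collect of an empty dequeue; sub-queues in `same` were seen empty and unchanged. -/
  | deqCollect (o : ℕ) (w : ℕ) (obs : Fin N → Option (ℕ × ℕ)) (same : Finset (Fin N))
  /-- About to return. -/
  | ret (o : ℕ) (r : Ret α)

/-- Labels of atomic steps. `put` and `take` are the successful updates of sub-queues: operation `o`
enqueues (dequeues) the item `x` as the node `p` of sub-queue `j`, while the
tail window (head window) is `W`. -/
inductive Action (α : Type*) (N : ℕ) where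
  | inv (o : ℕ) (op : Op α)
  | res (o : ℕ) (r : Ret α)
  | put (o : ℕ) (x : α) (j : Fin N) (p : ℕ) (W : Window)
  | take (o : ℕ) (x : α) (j : Fin N) (p : ℕ) (W : Window)
  | tau

/-! ## The algorithm -/

/-- Atomic steps of one thread, `ThreadStep g c a g' c'`: in shared state `g` and local state `c`, the
thread may perform the action `a`, after which the states are `g'` and `c'`. The order in which the
sub-queues of a window are searched is left open, and a search may be restarted at any time. -/
inductive ThreadStep {α : Type*} {N : ℕ} :
    Shared α N → Pc α N → Action α N → Shared α N → Pc α N → Prop where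
  -- Invocation and response
  | invEnq (g : Shared α N) (x : α) :
      ThreadStep g Pc.idle (Action.inv g.nextOp (Op.enq x))
        { g with nextOp := g.nextOp + 1 } (Pc.enqStart g.nextOp x)
  | invDeq (g : Shared α N) :
      ThreadStep g Pc.idle (Action.inv g.nextOp Op.deq)
        { g with nextOp := g.nextOp + 1 } (Pc.deqStart g.nextOp)
  | response (g : Shared α N) (o : ℕ) (r : Ret α) :
      ThreadStep g (Pc.ret o r) (Action.res o r) g Pc.idle
  -- Enqueue: read the tail window
  | enqRead (g : Shared α N) (o : ℕ) (x : α) (w : ℕ) :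
      g.lateral.IsTail w →
      ThreadStep g (Pc.enqStart o x) Action.tau g (Pc.enqSearch o x w ∅)
  | enqRestart (g : Shared α N) (o : ℕ) (x : α) (w : ℕ) (full : Finset (Fin N)) :
      ThreadStep g (Pc.enqSearch o x w full) Action.tau g (Pc.enqStart o x)
  -- Sub-queue `j` is below the maximum of the window: the new row is one above its last row, and
  -- above the bottom of the window
  | enqFound (g : Shared α N) (o : ℕ) (x : α) (w : ℕ) (full : Finset (Fin N))
      (W : Window) (j : Fin N) (last : ℕ) (nd : Node α) :
      g.lateral.nodes[w]? = some W → (j : ℕ) < W.width →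
      (g.sub j).IsTail last → (g.sub j).nodes[last]? = some nd → nd.row < W.max →
      ThreadStep g (Pc.enqSearch o x w full) Action.tau g
        (Pc.enqTry o x w j last (max (W.max - W.depth) nd.row + 1))
  -- Sub-queue `j` has reached the maximum of the window
  | enqFull (g : Shared α N) (o : ℕ) (x : α) (w : ℕ) (full : Finset (Fin N))
      (W : Window) (j : Fin N) (last : ℕ) (nd : Node α) :
      g.lateral.nodes[w]? = some W → (j : ℕ) < W.width →
      (g.sub j).IsTail last → (g.sub j).nodes[last]? = some nd → W.max ≤ nd.row →
      ThreadStep g (Pc.enqSearch o x w full) Action.tau g (Pc.enqSearch o x w (insert j full))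
  -- Try to enqueue on the sub-queue
  | enqSuccess (g : Shared α N) (o : ℕ) (x : α) (w : ℕ) (j : Fin N) (last row : ℕ)
      (q : MSQueue (Node α)) (W : Window) :
      (g.sub j).enqueue? last ⟨some x, row⟩ = some q → g.TailWindow W →
      ThreadStep g (Pc.enqTry o x w j last row) (Action.put o x j (last + 1) W)
        { g with sub := Function.update g.sub j q } (Pc.ret o Ret.ack)
  | enqFail (g : Shared α N) (o : ℕ) (x : α) (w : ℕ) (j : Fin N) (last row : ℕ) :
      (g.sub j).enqueue? last ⟨some x, row⟩ = none →
      ThreadStep g (Pc.enqTry o x w j last row) Action.tau g (Pc.enqStart o x)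
  -- All sub-queues of the window were seen at its maximum: shift the tail window
  | shiftTail (g : Shared α N) (o : ℕ) (x : α) (w : ℕ) (full : Finset (Fin N)) (W : Window) :
      g.lateral.nodes[w]? = some W → (∀ j : Fin N, (j : ℕ) < W.width → j ∈ full) →
      ThreadStep g (Pc.enqSearch o x w full) Action.tau g (Pc.shiftTail o x w)
  | shiftTailDepth (g : Shared α N) (o : ℕ) (x : α) (w : ℕ) :
      ThreadStep g (Pc.shiftTail o x w) Action.tau g (Pc.shiftTailWidth o x w g.depthShared)
  | shiftTailWidth (g : Shared α N) (o : ℕ) (x : α) (w depth : ℕ) (W : Window) :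
      g.lateral.nodes[w]? = some W →
      ThreadStep g (Pc.shiftTailWidth o x w depth) Action.tau g
        (Pc.shiftTailTry o x w
          { max := W.max + depth, depth := depth, width := g.widthShared })
  | shiftTailSuccess (g : Shared α N) (o : ℕ) (x : α) (w : ℕ) (new : Window) (L : MSQueue Window) :
      g.lateral.enqueue? w new = some L →
      ThreadStep g (Pc.shiftTailTry o x w new) Action.tau
        { g with lateral := L } (Pc.enqStart o x)
  | shiftTailFail (g : Shared α N) (o : ℕ) (x : α) (w : ℕ) (new : Window) :
      g.lateral.enqueue? w new = none →
      ThreadStep g (Pc.shiftTailTry o x w new) Action.tau g (Pc.enqStart o x)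
  -- Dequeue: read the head window
  | deqRead (g : Shared α N) (o : ℕ) :
      ThreadStep g (Pc.deqStart o) Action.tau g
        (Pc.deqSearch o g.lateral.head fun _ => none)
  | deqRestart (g : Shared α N) (o w : ℕ) (obs : Fin N → Option (ℕ × ℕ)) :
      ThreadStep g (Pc.deqSearch o w obs) Action.tau g (Pc.deqStart o)
  -- The first item of sub-queue `j` lies in the window
  | deqFound (g : Shared α N) (o w : ℕ) (obs : Fin N → Option (ℕ × ℕ))
      (W : Window) (j : Fin N) (nd : Node α) :
      g.lateral.nodes[w]? = some W → (j : ℕ) < W.width →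
      (g.sub j).nodes[(g.sub j).head + 1]? = some nd → nd.row ≤ W.max →
      ThreadStep g (Pc.deqSearch o w obs) Action.tau g (Pc.deqTry o w j (g.sub j).head)
  -- Sub-queue `j` is empty, or its first item lies above the window
  | deqNone (g : Shared α N) (o w : ℕ) (obs : Fin N → Option (ℕ × ℕ))
      (W : Window) (j : Fin N) (dummy : Node α) :
      g.lateral.nodes[w]? = some W → (j : ℕ) < W.width →
      (g.sub j).nodes[(g.sub j).head]? = some dummy →
      (∀ nd : Node α, (g.sub j).nodes[(g.sub j).head + 1]? = some nd → W.max < nd.row) →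
      ThreadStep g (Pc.deqSearch o w obs) Action.tau g
        (Pc.deqSearch o w (Function.update obs j (some ((g.sub j).head, dummy.row))))
  -- Try to dequeue from the sub-queue
  | deqSuccess (g : Shared α N) (o w : ℕ) (j : Fin N) (h : ℕ) (q : MSQueue (Node α))
      (nd : Node α) (x : α) (W : Window) :
      (g.sub j).dequeue? h = some q → (g.sub j).nodes[h + 1]? = some nd → nd.item = some x →
      g.HeadWindow W →
      ThreadStep g (Pc.deqTry o w j h) (Action.take o x j (h + 1) W)
        { g with sub := Function.update g.sub j q } (Pc.ret o (Ret.item x))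
  | deqFail (g : Shared α N) (o w : ℕ) (j : Fin N) (h : ℕ) :
      (g.sub j).dequeue? h = none →
      ThreadStep g (Pc.deqTry o w j h) Action.tau g (Pc.deqStart o)
  -- All sub-queues of the window were seen dequeued up to its maximum: shift the head window
  -- (which fails if there is no later window)
  | shiftHead (g : Shared α N) (o w : ℕ) (obs : Fin N → Option (ℕ × ℕ)) (W : Window) :
      g.lateral.nodes[w]? = some W →
      (∀ j : Fin N, (j : ℕ) < W.width → ∃ h r : ℕ, obs j = some (h, r) ∧ W.max ≤ r) →
      ThreadStep g (Pc.deqSearch o w obs) Action.tau g (Pc.shiftHead o w)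
  | shiftHeadSuccess (g : Shared α N) (o w : ℕ) (L : MSQueue Window) :
      g.lateral.dequeue? w = some L →
      ThreadStep g (Pc.shiftHead o w) Action.tau { g with lateral := L } (Pc.deqStart o)
  | shiftHeadFail (g : Shared α N) (o w : ℕ) :
      g.lateral.dequeue? w = none →
      ThreadStep g (Pc.shiftHead o w) Action.tau g (Pc.deqStart o)
  -- No sub-queue of the window was seen with an item in the window and there is no later window:
  -- collect a second time, and return empty if all are still empty and unchanged
  | collect (g : Shared α N) (o w : ℕ) (obs : Fin N → Option (ℕ × ℕ)) (W : Window) :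
      g.lateral.nodes[w]? = some W → (∀ j : Fin N, (j : ℕ) < W.width → (obs j).isSome) →
      g.lateral.IsTail w →
      ThreadStep g (Pc.deqSearch o w obs) Action.tau g (Pc.deqCollect o w obs ∅)
  | collectSame (g : Shared α N) (o w : ℕ) (obs : Fin N → Option (ℕ × ℕ)) (same : Finset (Fin N))
      (j : Fin N) (r : ℕ) :
      obs j = some ((g.sub j).head, r) → (g.sub j).IsTail (g.sub j).head →
      ThreadStep g (Pc.deqCollect o w obs same) Action.tau g (Pc.deqCollect o w obs (insert j same))
  | collectRestart (g : Shared α N) (o w : ℕ) (obs : Fin N → Option (ℕ × ℕ))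
      (same : Finset (Fin N)) :
      ThreadStep g (Pc.deqCollect o w obs same) Action.tau g (Pc.deqStart o)
  | collectDone (g : Shared α N) (o w : ℕ) (obs : Fin N → Option (ℕ × ℕ)) (same : Finset (Fin N))
      (W : Window) :
      g.lateral.nodes[w]? = some W → (∀ j : Fin N, (j : ℕ) < W.width → j ∈ same) →
      ThreadStep g (Pc.deqCollect o w obs same) Action.tau g (Pc.ret o Ret.empty)

/-- Global state with threads `T`. -/
structure State (α T : Type*) (N : ℕ) where
  shared : Shared α N
  pc : T → Pc α N

/-- Steps of the system: a thread moves, or the relaxation parameters are reconfigured, at any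
time and to any positive depth and any positive width up to the number of sub-queues. -/
inductive Step {α T : Type*} [DecidableEq T] {N : ℕ} :
    State α T N → Action α N → State α T N → Prop where
  | thread (s : State α T N) (t : T) (a : Action α N) (g' : Shared α N) (c' : Pc α N) :
      ThreadStep s.shared (s.pc t) a g' c' → Step s a ⟨g', Function.update s.pc t c'⟩
  | setDepth (s : State α T N) (d : ℕ) :
      1 ≤ d → Step s Action.tau { s with shared := { s.shared with depthShared := d } }
  | setWidth (s : State α T N) (w : ℕ) :
      1 ≤ w → w ≤ N → Step s Action.tau { s with shared := { s.shared with widthShared := w } }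

/-- Initial state: empty sub-queues (only a dummy of row `0`), one window of depth `d` and width
`w` at the bottom, no operation running. -/
def initial (α T : Type*) (N d w : ℕ) : State α T N where
  shared :=
    { sub := fun _ => ⟨[⟨none, 0⟩], 0⟩
      lateral := ⟨[{ max := d, depth := d, width := w }], 0⟩
      depthShared := d
      widthShared := w
      nextOp := 0 }
  pc := fun _ => Pc.idle

/-- `Execution s₀ tr s`: the finite execution with the sequence of actions `tr` leads from `s₀`
to `s`. -/
inductive Execution {α T : Type*} [DecidableEq T] {N : ℕ} (s₀ : State α T N) :
    List (Action α N) → State α T N → Prop where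
  | nil : Execution s₀ [] s₀
  | snoc (tr : List (Action α N)) (s : State α T N) (a : Action α N) (s' : State α T N) :
      Execution s₀ tr s → Step s a s' → Execution s₀ (tr ++ [a]) s'

/-- The invocation or response carried by an action. -/
def Action.event? {α : Type*} {N : ℕ} : Action α N → Option (Event α)
  | .inv o op => some (.inv o op)
  | .res o r => some (.res o r)
  | _ => none

/-- The concurrent history of an execution. -/
def history {α : Type*} {N : ℕ} (tr : List (Action α N)) : List (Event α) :=
  tr.filterMap Action.event?

/-- The head window at the moment when the dequeue `o` takes its item, if it has taken one. -/
def headWindowOf {α : Type*} {N : ℕ} (tr : List (Action α N)) (o : ℕ) : Option Window :=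
  tr.findSome? fun a =>
    match a with
    | .take o' _ _ _ W => if o' = o then some W else none
    | _ => none

/-- The elastic rank error bound `(W.width - 1) * W.depth` of the dequeue `o`, where `W` is the head
window when `o` takes its item (widths are always positive; `0` if no item has been taken). -/
def rankBound {α : Type*} {N : ℕ} (tr : List (Action α N)) (o : ℕ) : ℕ :=
  match headWindowOf tr o with
  | some W => (W.width - 1) * W.depth
  | none => 0

end ElasticLaW

namespace ElasticLaW

variable {α T : Type*} {N : ℕ}

/-! ## Lists -/

/-! An enqueue is linearized when its node is appended to a sub-queue, a non-empty dequeue when the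
head of the sub-queue moves. The sequential queue then lists the live items in the order in which
they were put (`Contents`), and every new call goes to the end of the linearization.

The geometry rests on two monotone facts (`SharedInv`): a window gets a successor only after each of
its sub-queues has reached its maximal row, and it is left by the head only after each has been
dequeued up to that row. Rows increase strictly along a sub-queue and windows span disjoint rows.
Hence a stale enqueue or dequeue must fail: a successful put happens in the current tail window
(`SharedInv.isTail_of_enqTry`), a successful take in the current head window
(`SharedInv.isHead_of_deqTry`). So the windows of live items are nondecreasing in put order, and no
live item lies before the head window.

For the rank (`Contents.rank_le`), let a dequeue take an item of the head window. All earlier live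
items lie in that window too, and none in the same sub-queue, whose first item is being taken. Their
pairs (sub-queue, row) are distinct and fill at most `width - 1` columns of `depth` rows.

The empty dequeue is the delicate case, because whether its second collect succeeds is known only
later. When this collect starts, head and tail window coincide. If no item is live, the call is
linearized at once and tentatively; should the collect be abandoned, the call is deleted again,
which is harmless because it is pending and leaves the contents unchanged. If some item is live, its
sub-queue already has a node after the dummy recorded in the first collect. Nodes are never
unlinked, so this sub-queue can never pass the second collect (`Contents.doomed`). -/

theorem getElem?_of_prefix {β : Type*} {l l' : List β} (h : l <+: l') {i : ℕ} {b : β}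
    (hi : l[i]? = some b) : l'[i]? = some b := by
  obtain ⟨m, rfl⟩ := h
  obtain ⟨hlt, -⟩ := List.getElem?_eq_some_iff.mp hi
  rwa [List.getElem?_append_left hlt]

theorem lt_length_of_getElem? {β : Type*} {l : List β} {i : ℕ} {b : β}
    (hi : l[i]? = some b) : i < l.length :=
  (List.getElem?_eq_some_iff.mp hi).1

theorem exists_getElem? {β : Type*} {l : List β} {i : ℕ} (hi : i < l.length) :
    ∃ b, l[i]? = some b :=
  ⟨l[i], List.getElem?_eq_getElem hi⟩

theorem rel_of_pairwise {β : Type*} {R : β → β → Prop} {l : List β} (h : l.Pairwise R)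
    {i k : ℕ} {a b : β} (hi : l[i]? = some a) (hk : l[k]? = some b) (hik : i < k) : R a b := by
  obtain ⟨hi', rfl⟩ := List.getElem?_eq_some_iff.mp hi
  obtain ⟨hk', rfl⟩ := List.getElem?_eq_some_iff.mp hk
  exact List.pairwise_iff_getElem.mp h i k hi' hk' hik

/-! ## Monotone evolution of the shared memory -/

/-- Nodes are only appended, and head pointers only advance. -/
structure Extends (g g' : Shared α N) : Prop where
  sub : ∀ j, (g.sub j).nodes <+: (g'.sub j).nodes
  subHead : ∀ j, (g.sub j).head ≤ (g'.sub j).head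
  lateral : g.lateral.nodes <+: g'.lateral.nodes
  lateralHead : g.lateral.head ≤ g'.lateral.head

theorem Extends.of_eq {g g' : Shared α N} (h : g'.sub = g.sub) (h' : g'.lateral = g.lateral) :
    Extends g g' := by
  constructor <;> simp [h, h']

theorem Extends.of_update {g : Shared α N} {j : Fin N} {q : MSQueue (Node α)}
    (h : (g.sub j).nodes <+: q.nodes) (h' : (g.sub j).head ≤ q.head) :
    Extends g { g with sub := Function.update g.sub j q } := by
  constructor
  · intro i
    by_cases hi : i = j
    · subst hi; simpa using h
    · simp [hi]
  · intro i
    by_cases hi : i = j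
    · subst hi; simpa using h'
    · simp [hi]
  · simp
  · simp

theorem Extends.of_lateral {g : Shared α N} {L : MSQueue Window}
    (h : g.lateral.nodes <+: L.nodes) (h' : g.lateral.head ≤ L.head) :
    Extends g { g with lateral := L } :=
  ⟨fun _ => List.prefix_rfl, fun _ => le_rfl, h, h'⟩

theorem MSQueue.enqueue?_eq_some {β : Type*} {q q' : MSQueue β} {p : ℕ} {b : β}
    (h : q.enqueue? p b = some q') :
    p + 1 = q.nodes.length ∧ q' = ⟨q.nodes ++ [b], q.head⟩ := by
  unfold MSQueue.enqueue? at h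
  split_ifs at h with hp
  exact ⟨hp, (Option.some.inj h).symm⟩

theorem MSQueue.dequeue?_eq_some {β : Type*} {q q' : MSQueue β} {p : ℕ}
    (h : q.dequeue? p = some q') :
    q.head = p ∧ p + 1 < q.nodes.length ∧ q' = ⟨q.nodes, p + 1⟩ := by
  unfold MSQueue.dequeue? at h
  split_ifs at h with hp
  exact ⟨hp.1, hp.2, (Option.some.inj h).symm⟩

theorem ThreadStep.extends {g g' : Shared α N} {c c' : Pc α N} {a : Action α N}
    (h : ThreadStep g c a g' c') : Extends g g' := by
  cases h with
  | enqSuccess o x w j last row q W hq _ =>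
    obtain ⟨-, rfl⟩ := MSQueue.enqueue?_eq_some hq
    exact Extends.of_update (List.prefix_append _ _) le_rfl
  | deqSuccess o w j h q nd x W hq =>
    obtain ⟨hh, -, rfl⟩ := MSQueue.dequeue?_eq_some hq
    exact Extends.of_update List.prefix_rfl (by simp [hh])
  | shiftTailSuccess o x w new L hL =>
    obtain ⟨-, rfl⟩ := MSQueue.enqueue?_eq_some hL
    exact Extends.of_lateral (List.prefix_append _ _) le_rfl
  | shiftHeadSuccess o w L hL =>
    obtain ⟨hh, -, rfl⟩ := MSQueue.dequeue?_eq_some hL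
    exact Extends.of_lateral List.prefix_rfl (by simp [hh])
  | _ => exact Extends.of_eq rfl rfl

/-! ## Invariants of the shared memory and of the local states -/

/-- Sub-queue `j` has been filled up to the row `M`. -/
def Full (g : Shared α N) (j : Fin N) (M : ℕ) : Prop :=
  ∃ nd ∈ (g.sub j).nodes, M ≤ nd.row

/-- Sub-queue `j` has been dequeued up to the row `M`. -/
def Drained (g : Shared α N) (j : Fin N) (M : ℕ) : Prop :=
  ∃ h nd, h ≤ (g.sub j).head ∧ (g.sub j).nodes[h]? = some nd ∧ M ≤ nd.row

theorem Full.mono {g g' : Shared α N} (e : Extends g g') {j : Fin N} {M : ℕ}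
    (h : Full g j M) : Full g' j M := by
  obtain ⟨nd, hnd, hM⟩ := h
  exact ⟨nd, (e.sub j).subset hnd, hM⟩

theorem Drained.mono {g g' : Shared α N} (e : Extends g g') {j : Fin N} {M : ℕ}
    (h : Drained g j M) : Drained g' j M := by
  obtain ⟨p, nd, hp, hnd, hM⟩ := h
  exact ⟨p, nd, hp.trans (e.subHead j), getElem?_of_prefix (e.sub j) hnd, hM⟩

/-- Rows increase along every sub-queue, the windows of the Lateral are disjoint and increase, all
windows before the tail are full and all windows before the head are drained. Depths
are positive. -/
structure SharedInv (g : Shared α N) : Prop where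
  rows : ∀ j, (g.sub j).nodes.Pairwise fun a b => a.row < b.row
  head_lt : ∀ j, (g.sub j).head < (g.sub j).nodes.length
  windows : g.lateral.nodes.Pairwise fun V W => V.max + W.depth ≤ W.max
  depth_pos : ∀ W ∈ g.lateral.nodes, 1 ≤ W.depth
  depthShared_pos : 1 ≤ g.depthShared
  lateralHead_lt : g.lateral.head < g.lateral.nodes.length
  full : ∀ w W, w + 1 < g.lateral.nodes.length → g.lateral.nodes[w]? = some W →
    ∀ j : Fin N, (j : ℕ) < W.width → Full g j W.max
  drained : ∀ w W, w < g.lateral.head → g.lateral.nodes[w]? = some W →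
    ∀ j : Fin N, (j : ℕ) < W.width → Drained g j W.max

/-- What a thread knows about the shared memory. -/
def LocalInv (g : Shared α N) : Pc α N → Prop
  | .enqSearch _ _ w full =>
      ∃ W, g.lateral.nodes[w]? = some W ∧ ∀ j ∈ full, Full g j W.max
  | .enqTry _ _ w j last row =>
      ∃ W nd, g.lateral.nodes[w]? = some W ∧ (j : ℕ) < W.width ∧
        (g.sub j).nodes[last]? = some nd ∧ nd.row < row ∧ nd.row < W.max ∧
        W.max - W.depth < row ∧ row ≤ W.max
  | .shiftTail _ _ w =>
      ∃ W, g.lateral.nodes[w]? = some W ∧ ∀ j : Fin N, (j : ℕ) < W.width → Full g j W.max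
  | .shiftTailWidth _ _ w depth => 1 ≤ depth ∧
      ∃ W, g.lateral.nodes[w]? = some W ∧ ∀ j : Fin N, (j : ℕ) < W.width → Full g j W.max
  | .shiftTailTry _ _ w new => 1 ≤ new.depth ∧
      ∃ W, g.lateral.nodes[w]? = some W ∧ W.max + new.depth ≤ new.max ∧
        ∀ j : Fin N, (j : ℕ) < W.width → Full g j W.max
  | .deqSearch _ w obs =>
      w ≤ g.lateral.head ∧ ∀ j h r, obs j = some (h, r) →
        h ≤ (g.sub j).head ∧ ∃ nd, (g.sub j).nodes[h]? = some nd ∧ nd.row = r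
  | .deqTry _ w j h =>
      w ≤ g.lateral.head ∧ ∃ W nd, g.lateral.nodes[w]? = some W ∧ (j : ℕ) < W.width ∧
        (g.sub j).nodes[h + 1]? = some nd ∧ nd.row ≤ W.max
  | .shiftHead _ w =>
      ∃ W, g.lateral.nodes[w]? = some W ∧ ∀ j : Fin N, (j : ℕ) < W.width → Drained g j W.max
  | _ => True

theorem LocalInv.mono {g g' : Shared α N} (e : Extends g g') {c : Pc α N}
    (h : LocalInv g c) : LocalInv g' c := by
  cases c with
  | enqSearch o x w full =>
    obtain ⟨W, hW, hf⟩ := h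
    exact ⟨W, getElem?_of_prefix e.lateral hW, fun j hj => (hf j hj).mono e⟩
  | enqTry o x w j last row =>
    obtain ⟨W, nd, hW, hj, hnd, hr⟩ := h
    exact ⟨W, nd, getElem?_of_prefix e.lateral hW, hj, getElem?_of_prefix (e.sub j) hnd, hr⟩
  | shiftTail o x w =>
    obtain ⟨W, hW, hf⟩ := h
    exact ⟨W, getElem?_of_prefix e.lateral hW, fun j hj => (hf j hj).mono e⟩
  | shiftTailWidth o x w d =>
    obtain ⟨hd, W, hW, hf⟩ := h
    exact ⟨hd, W, getElem?_of_prefix e.lateral hW, fun j hj => (hf j hj).mono e⟩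
  | shiftTailTry o x w new =>
    obtain ⟨hd, W, hW, hm, hf⟩ := h
    exact ⟨hd, W, getElem?_of_prefix e.lateral hW, hm, fun j hj => (hf j hj).mono e⟩
  | deqSearch o w obs =>
    obtain ⟨hw, hobs⟩ := h
    refine ⟨hw.trans e.lateralHead, fun j p r hj => ?_⟩
    obtain ⟨hp, nd, hnd, hr⟩ := hobs j p r hj
    exact ⟨hp.trans (e.subHead j), nd, getElem?_of_prefix (e.sub j) hnd, hr⟩
  | deqTry o w j p =>
    obtain ⟨hw, W, nd, hW, hj, hnd, hr⟩ := h
    exact ⟨hw.trans e.lateralHead, W, nd, getElem?_of_prefix e.lateral hW, hj,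
      getElem?_of_prefix (e.sub j) hnd, hr⟩
  | shiftHead o w =>
    obtain ⟨W, hW, hf⟩ := h
    exact ⟨W, getElem?_of_prefix e.lateral hW, fun j hj => (hf j hj).mono e⟩
  | _ => trivial

/-! ### Comparing rows with full and drained windows -/

theorem SharedInv.row_le_of_le {g : Shared α N} (hg : SharedInv g) {j : Fin N} {p p' : ℕ}
    {a b : Node α} (ha : (g.sub j).nodes[p]? = some a) (hb : (g.sub j).nodes[p']? = some b)
    (hp : p ≤ p') : a.row ≤ b.row := by
  rcases hp.eq_or_lt with rfl | hp
  · rw [ha] at hb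
    rw [Option.some.inj hb]
  · exact (rel_of_pairwise (hg.rows j) ha hb hp).le

theorem SharedInv.le_row_of_full {g : Shared α N} (hg : SharedInv g) {j : Fin N} {M p : ℕ}
    {nd : Node α} (hf : Full g j M) (hp : p + 1 = (g.sub j).nodes.length)
    (hnd : (g.sub j).nodes[p]? = some nd) : M ≤ nd.row := by
  obtain ⟨a, ha, hM⟩ := hf
  obtain ⟨i, hi⟩ := List.mem_iff_getElem?.mp ha
  have := lt_length_of_getElem? hi
  exact hM.trans (hg.row_le_of_le hi hnd (by omega))

theorem SharedInv.lt_row_of_drained {g : Shared α N} (hg : SharedInv g) {j : Fin N} {M p : ℕ}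
    {nd : Node α} (hd : Drained g j M) (hp : (g.sub j).head < p)
    (hnd : (g.sub j).nodes[p]? = some nd) : M < nd.row := by
  obtain ⟨i, a, hi, ha, hM⟩ := hd
  exact hM.trans_lt (rel_of_pairwise (hg.rows j) ha hnd (by omega))

/-- A successful enqueue on a sub-queue takes place in the current tail window. -/
theorem SharedInv.isTail_of_enqTry {g : Shared α N} (hg : SharedInv g) {o : ℕ} {x : α} {w : ℕ}
    {j : Fin N} {last row : ℕ} (hl : LocalInv g (.enqTry o x w j last row))
    (hlast : last + 1 = (g.sub j).nodes.length) : w + 1 = g.lateral.nodes.length := by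
  obtain ⟨W, nd, hW, hj, hnd, -, hlt, -⟩ := hl
  by_contra hne
  have := lt_length_of_getElem? hW
  -- A window that is not the tail is full, so the last row would be at least `W.max`, whereas it
  -- was read below it.
  have := hg.le_row_of_full (hg.full w W (by omega) hW j hj) hlast hnd
  omega

/-- A successful dequeue from a sub-queue takes place in the current head window. -/
theorem SharedInv.isHead_of_deqTry {g : Shared α N} (hg : SharedInv g) {o w : ℕ}
    {j : Fin N} {h : ℕ} (hl : LocalInv g (.deqTry o w j h))
    (hh : (g.sub j).head = h) : w = g.lateral.head := by
  obtain ⟨hw, W, nd, hW, hj, hnd, hle⟩ := hl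
  by_contra hne
  -- A window before the head is drained, so everything past the dummy lies above `W.max`, whereas
  -- the item was read at a row inside.
  have := hg.lt_row_of_drained (hg.drained w W (by omega) hW j hj) (by omega) hnd
  omega

/-! ### Preservation of the invariants by steps -/

theorem SharedInv.of_eq {g g' : Shared α N} (hg : SharedInv g) (h : g'.sub = g.sub)
    (h' : g'.lateral = g.lateral) (hd : 1 ≤ g'.depthShared) : SharedInv g' := by
  have e := Extends.of_eq h h'
  constructor
  · rw [h]; exact hg.rows
  · rw [h]; exact hg.head_lt
  · rw [h']; exact hg.windows
  · rw [h']; exact hg.depth_pos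
  · exact hd
  · rw [h']; exact hg.lateralHead_lt
  · rw [h']; exact fun w W hw hW j hj => (hg.full w W hw hW j hj).mono e
  · rw [h']; exact fun w W hw hW j hj => (hg.drained w W hw hW j hj).mono e

theorem SharedInv.of_update {g : Shared α N} (hg : SharedInv g) {j : Fin N}
    {q : MSQueue (Node α)} (h : (g.sub j).nodes <+: q.nodes) (h' : (g.sub j).head ≤ q.head)
    (hrows : q.nodes.Pairwise fun a b => a.row < b.row) (hlt : q.head < q.nodes.length) :
    SharedInv { g with sub := Function.update g.sub j q } := by
  have e := Extends.of_update h h'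
  constructor
  · intro i
    by_cases hi : i = j
    · subst hi; simpa using hrows
    · simpa [hi] using hg.rows i
  · intro i
    by_cases hi : i = j
    · subst hi; simpa using hlt
    · simpa [hi] using hg.head_lt i
  · exact hg.windows
  · exact hg.depth_pos
  · exact hg.depthShared_pos
  · exact hg.lateralHead_lt
  · exact fun w W hw hW j hj => (hg.full w W hw hW j hj).mono e
  · exact fun w W hw hW j hj => (hg.drained w W hw hW j hj).mono e

theorem SharedInv.step {g g' : Shared α N} {c c' : Pc α N} {a : Action α N} (hg : SharedInv g)
    (hl : LocalInv g c) (h : ThreadStep g c a g' c') : SharedInv g' := by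
  have e := h.extends
  cases h with
  | enqSuccess o x w j last row q W hq _ =>
    obtain ⟨hlast, rfl⟩ := MSQueue.enqueue?_eq_some hq
    obtain ⟨W, nd, -, -, hnd, hrow, -⟩ := hl
    refine hg.of_update (List.prefix_append _ _) le_rfl ?_ ?_
    · refine List.pairwise_append.mpr ⟨hg.rows j, List.pairwise_singleton _ _, ?_⟩
      intro a ha b hb
      obtain rfl := List.mem_singleton.mp hb
      obtain ⟨i, hi⟩ := List.mem_iff_getElem?.mp ha
      have := lt_length_of_getElem? hi
      exact (hg.row_le_of_le hi hnd (by omega)).trans_lt hrow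
    · have := hg.head_lt j
      simp only [List.length_append, List.length_singleton]
      omega
  | deqSuccess o w j h q nd x W hq =>
    obtain ⟨hh, hlt, rfl⟩ := MSQueue.dequeue?_eq_some hq
    exact hg.of_update List.prefix_rfl (by simp [hh]) (hg.rows j) hlt
  | shiftTailSuccess o x w new L hL =>
    obtain ⟨hw, rfl⟩ := MSQueue.enqueue?_eq_some hL
    obtain ⟨hdepth, V, hV, hmax, hfull⟩ := hl
    refine ⟨hg.rows, hg.head_lt, ?_, ?_, hg.depthShared_pos, ?_, ?_, ?_⟩
    · refine List.pairwise_append.mpr ⟨hg.windows, List.pairwise_singleton _ _, ?_⟩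
      intro A hA B hB
      obtain rfl := List.mem_singleton.mp hB
      obtain ⟨i, hi⟩ := List.mem_iff_getElem?.mp hA
      have := lt_length_of_getElem? hi
      -- The thread knows the gap only for the direct predecessor `w`; older windows lie below `w`
      -- already.
      rcases (show i ≤ w by omega).eq_or_lt with rfl | hiw
      · rw [hV] at hi
        obtain rfl := Option.some.inj hi
        exact hmax
      · have := rel_of_pairwise hg.windows hi hV hiw
        omega
    · intro A hA
      rcases List.mem_append.mp hA with hA | hA
      · exact hg.depth_pos A hA
      · obtain rfl := List.mem_singleton.mp hA
        exact hdepth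
    · have := hg.lateralHead_lt
      simp only [List.length_append, List.length_singleton]
      omega
    · intro v A hv hA j hj
      simp only [List.length_append, List.length_singleton] at hv hA
      rw [List.getElem?_append_left (by omega)] at hA
      -- Only `w` has just stopped being the tail; its fullness is what the search of the thread
      -- established.
      rcases (show v ≤ w by omega).eq_or_lt with rfl | hvw
      · rw [hV] at hA
        obtain rfl := Option.some.inj hA
        exact hfull j hj
      · exact hg.full v A (by omega) hA j hj
    · intro v A hv hA j hj
      have := hg.lateralHead_lt
      simp only at hv hA
      rw [List.getElem?_append_left (by omega)] at hA
      exact hg.drained v A hv hA j hj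
  | shiftHeadSuccess o w L hL =>
    obtain ⟨hh, hlt, rfl⟩ := MSQueue.dequeue?_eq_some hL
    obtain ⟨V, hV, hdr⟩ := hl
    refine ⟨hg.rows, hg.head_lt, hg.windows, hg.depth_pos, hg.depthShared_pos, hlt, hg.full, ?_⟩
    intro v A hv hA j hj
    simp only at hv hA
    rcases (show v ≤ w by omega).eq_or_lt with rfl | hvw
    · rw [hV] at hA
      obtain rfl := Option.some.inj hA
      exact hdr j hj
    · exact hg.drained v A (by omega) hA j hj
  | _ => exact hg.of_eq rfl rfl hg.depthShared_pos

theorem LocalInv.step {g g' : Shared α N} {c c' : Pc α N} {a : Action α N} (hg : SharedInv g)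
    (hl : LocalInv g c) (h : ThreadStep g c a g' c') : LocalInv g' c' := by
  cases h with
  | enqRead o x w hw =>
    obtain ⟨W, hW⟩ := exists_getElem? (l := g.lateral.nodes) (i := w)
      (by unfold MSQueue.IsTail at hw; omega)
    exact ⟨W, hW, by simp⟩
  | enqFound o x w full W j last nd hW hj hlast hnd hlt =>
    -- Positive depth keeps the bottom row `W.max - W.depth + 1` from exceeding `W.max`.
    have := hg.depth_pos W (List.mem_of_getElem? hW)
    refine ⟨W, nd, hW, hj, hnd, ?_, hlt, ?_, ?_⟩ <;> omega
  | enqFull o x w full W j last nd hW hj hlast hnd hle =>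
    obtain ⟨V, hV, hf⟩ := hl
    rw [hW] at hV
    obtain rfl := Option.some.inj hV
    refine ⟨W, hW, fun i hi => ?_⟩
    rcases Finset.mem_insert.mp hi with rfl | hi
    · exact ⟨nd, List.mem_of_getElem? hnd, hle⟩
    · exact hf i hi
  | shiftTail o x w full W hW hall =>
    obtain ⟨V, hV, hf⟩ := hl
    rw [hW] at hV
    obtain rfl := Option.some.inj hV
    exact ⟨W, hW, fun j hj => hf j (hall j hj)⟩
  | shiftTailDepth o x w => exact ⟨hg.depthShared_pos, hl⟩
  | shiftTailWidth o x w depth W hW =>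
    obtain ⟨hd, V, hV, hf⟩ := hl
    rw [hW] at hV
    obtain rfl := Option.some.inj hV
    exact ⟨hd, W, hW, le_rfl, hf⟩
  | deqRead o => exact ⟨le_rfl, by simp⟩
  | deqFound o w obs W j nd hW hj hnd hle => exact ⟨hl.1, W, nd, hW, hj, hnd, hle⟩
  | deqNone o w obs W j dummy hW hj hd _ =>
    refine ⟨hl.1, fun i p r hi => ?_⟩
    by_cases hij : i = j
    · subst hij
      simp only [Function.update_self, Option.some.injEq, Prod.mk.injEq] at hi
      obtain ⟨rfl, rfl⟩ := hi
      exact ⟨le_rfl, dummy, hd, rfl⟩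
    · rw [Function.update_of_ne hij] at hi
      exact hl.2 i p r hi
  | shiftHead o w obs W hW hall =>
    refine ⟨W, hW, fun j hj => ?_⟩
    obtain ⟨p, r, hobs, hle⟩ := hall j hj
    obtain ⟨hp, nd, hnd, rfl⟩ := hl.2 j p r hobs
    exact ⟨p, nd, hp, hnd, hle⟩
  | _ => trivial

/-! ## Histories and linearizations -/

theorem history_append_of_none {tr : List (Action α N)} {a : Action α N} (h : a.event? = none) :
    history (tr ++ [a]) = history tr := by
  simp [history, h]

theorem history_append_of_some {tr : List (Action α N)} {a : Action α N} {e : Event α}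
    (h : a.event? = some e) : history (tr ++ [a]) = history tr ++ [e] := by
  simp [history, h]

/-- Real-time order gains a pair only through a new invocation as the later element; a response
alone orders nothing. -/
theorem Precedes.of_append {H : List (Event α)} {e : Event α} {o o' : ℕ}
    (h : Precedes (H ++ [e]) o o') : Precedes H o o' ∨ ∃ op, e = .inv o' op := by
  obtain ⟨m, n, r, op, hmn, hm, hn⟩ := h
  have hlt := lt_length_of_getElem? hn
  simp only [List.length_append, List.length_singleton] at hlt
  rcases (show n ≤ H.length by omega).eq_or_lt with rfl | hnl
  · rw [List.getElem?_concat_length] at hn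
    exact .inr ⟨op, Option.some.inj hn⟩
  · rw [List.getElem?_append_left hnl] at hn
    rw [List.getElem?_append_left (by omega)] at hm
    exact .inl ⟨m, n, r, op, hmn, hm, hn⟩

theorem IsLinearization.append_inv {H : List (Event α)} {S : List (Call α)}
    (h : IsLinearization H S) {o : ℕ} {op : Op α} (ho : ∀ op', Event.inv o op' ∉ H) :
    IsLinearization (H ++ [.inv o op]) S where
  nodup := h.nodup
  invoked c hc := List.mem_append_left _ (h.invoked c hc)
  complete o' r hr := h.complete o' r (by simpa using hr)
  realTime := h.realTime.imp_of_mem fun {a b} ha _ hab hp => by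
    rcases hp.of_append with hp | ⟨op', heq⟩
    · exact hab hp
    · cases heq
      exact ho _ (h.invoked a ha)

theorem IsLinearization.append_res {H : List (Event α)} {S : List (Call α)}
    (h : IsLinearization H S) {o : ℕ} {r : Ret α} (ho : ∃ c ∈ S, c.id = o ∧ c.ret = r) :
    IsLinearization (H ++ [.res o r]) S where
  nodup := h.nodup
  invoked c hc := List.mem_append_left _ (h.invoked c hc)
  complete o' r' hr := by
    rcases List.mem_append.mp hr with hr | hr
    · exact h.complete o' r' hr
    · cases List.mem_singleton.mp hr
      exact ho
  realTime := h.realTime.imp fun hab hp => by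
    rcases hp.of_append with hp | ⟨op', heq⟩
    · exact hab hp
    · cases heq

/-- A pending operation has no response, hence precedes nothing and may be placed last. -/
theorem IsLinearization.append_call {H : List (Event α)} {S : List (Call α)}
    (h : IsLinearization H S) {c : Call α} (hc : c.id ∉ S.map Call.id)
    (hinv : Event.inv c.id c.op ∈ H) (hres : ∀ r, Event.res c.id r ∉ H) :
    IsLinearization H (S ++ [c]) where
  nodup := by
    rw [List.map_append, List.map_singleton, ← List.concat_eq_append]
    exact h.nodup.concat hc
  invoked c' hc' := by
    rcases List.mem_append.mp hc' with hc' | hc'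
    · exact h.invoked c' hc'
    · obtain rfl := List.mem_singleton.mp hc'
      exact hinv
  complete o r hr := by
    obtain ⟨c', hc', heq⟩ := h.complete o r hr
    exact ⟨c', List.mem_append_left _ hc', heq⟩
  realTime := List.pairwise_append.mpr ⟨h.realTime, List.pairwise_singleton _ _, by
    rintro a - b hb ⟨m, n, r, op, -, hm, -⟩
    obtain rfl := List.mem_singleton.mp hb
    exact hres r (List.mem_of_getElem? hm)⟩

/-- Without the call of a pending operation, a linearization remains one. -/
theorem IsLinearization.filter_pending {H : List (Event α)} {S : List (Call α)}
    (h : IsLinearization H S) {o : ℕ} (hres : ∀ r, Event.res o r ∉ H) :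
    IsLinearization H (S.filter fun c => c.id ≠ o) where
  nodup := h.nodup.sublist (List.filter_sublist.map _)
  invoked c hc := h.invoked c (List.mem_of_mem_filter hc)
  complete o' r hr := by
    obtain ⟨c, hc, rfl, heq⟩ := h.complete o' r hr
    refine ⟨c, List.mem_filter.mpr ⟨hc, ?_⟩, rfl, heq⟩
    simp only [ne_eq, decide_eq_true_eq]
    rintro rfl
    exact hres r hr
  realTime := h.realTime.sublist List.filter_sublist

/-! ## Runs of the relaxed queue -/

/-- The calls lead the relaxed queue from the contents `q` to the contents `q'`. -/
inductive RelaxedRun (k : ℕ → ℕ) : List α → List (Call α) → List α → Prop where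
  | nil (q : List α) : RelaxedRun k q [] q
  | enq (q q' : List α) (o : ℕ) (x : α) (S : List (Call α)) :
      RelaxedRun k (q ++ [x]) S q' → RelaxedRun k q (⟨o, Op.enq x, Ret.ack⟩ :: S) q'
  | deq (q q' : List α) (o : ℕ) (x : α) (rank : ℕ) (S : List (Call α)) :
      q[rank]? = some x → rank ≤ k o →
      RelaxedRun k (q.eraseIdx rank) S q' → RelaxedRun k q (⟨o, Op.deq, Ret.item x⟩ :: S) q'
  | deqEmpty (q' : List α) (o : ℕ) (S : List (Call α)) :
      RelaxedRun k [] S q' → RelaxedRun k [] (⟨o, Op.deq, Ret.empty⟩ :: S) q'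

theorem RelaxedRun.relaxedFIFO {k : ℕ → ℕ} {q q' : List α} {S : List (Call α)}
    (h : RelaxedRun k q S q') : RelaxedFIFO k q S := by
  induction h with
  | nil q => exact .nil q
  | enq q q' o x S _ ih => exact .enq q o x S ih
  | deq q q' o x rank S hx hk _ ih => exact .deq q o x rank S hx hk ih
  | deqEmpty q' o S _ ih => exact .deqEmpty o S ih

theorem RelaxedRun.mono {k k' : ℕ → ℕ} (hk : ∀ o, k o ≤ k' o) {q q' : List α}
    {S : List (Call α)} (h : RelaxedRun k q S q') : RelaxedRun k' q S q' := by
  induction h with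
  | nil q => exact .nil q
  | enq q q' o x S _ ih => exact .enq q q' o x S ih
  | deq q q' o x rank S hx hr _ ih => exact .deq q q' o x rank S hx (hr.trans (hk o)) ih
  | deqEmpty q' o S _ ih => exact .deqEmpty q' o S ih

theorem RelaxedRun.append {k : ℕ → ℕ} {q q' q'' : List α} {S S' : List (Call α)}
    (h : RelaxedRun k q S q') (h' : RelaxedRun k q' S' q'') : RelaxedRun k q (S ++ S') q'' := by
  induction h with
  | nil q => exact h'
  | enq q q' o x S _ ih => exact .enq q q'' o x _ (ih h')
  | deq q q' o x rank S hx hr _ ih => exact .deq q q'' o x rank _ hx hr (ih h')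
  | deqEmpty q' o S _ ih => exact .deqEmpty q'' o _ (ih h')

/-- Calls that return `empty` may be dropped. -/
theorem RelaxedRun.filter_empty {k : ℕ → ℕ} {q q' : List α} {S : List (Call α)} {o : ℕ}
    (h : RelaxedRun k q S q') (ho : ∀ c ∈ S, c.id = o → c.ret = .empty) :
    RelaxedRun k q (S.filter fun c => c.id ≠ o) q' := by
  induction h with
  | nil q => exact .nil q
  | enq q q' i x S _ ih =>
    have hi : i ≠ o := fun hi => by simpa using ho _ List.mem_cons_self hi
    simpa [hi] using RelaxedRun.enq q q' i x _ (ih fun c hc => ho c (List.mem_cons_of_mem _ hc))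
  | deq q q' i x rank S hx hr _ ih =>
    have hi : i ≠ o := fun hi => by simpa using ho _ List.mem_cons_self hi
    simpa [hi] using RelaxedRun.deq q q' i x rank _ hx hr
      (ih fun c hc => ho c (List.mem_cons_of_mem _ hc))
  | deqEmpty q' i S _ ih =>
    have := ih fun c hc => ho c (List.mem_cons_of_mem _ hc)
    by_cases hi : i = o
    · simpa [hi] using this
    · simpa [hi] using RelaxedRun.deqEmpty q' i _ this

/-! ### The rank bound along a growing trace -/

theorem headWindowOf_append_of_some {tr tr' : List (Action α N)} {o : ℕ} {W : Window}
    (h : headWindowOf tr o = some W) : headWindowOf (tr ++ tr') o = some W := by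
  unfold headWindowOf at h ⊢
  rw [List.findSome?_append, h, Option.some_or]

/-- The first take of `o` fixes the bound for good, and before it the default `0` is the least
value. Runs built for a shorter trace thus stay valid. -/
theorem rankBound_le_append (tr tr' : List (Action α N)) (o : ℕ) :
    rankBound tr o ≤ rankBound (tr ++ tr') o := by
  unfold rankBound
  cases h : headWindowOf tr o with
  | none => exact Nat.zero_le _
  | some W => rw [headWindowOf_append_of_some h]

theorem rankBound_append_take {tr : List (Action α N)} {o : ℕ} {x : α} {j : Fin N} {p : ℕ}
    {W : Window} (h : headWindowOf tr o = none) :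
    rankBound (tr ++ [.take o x j p W]) o = (W.width - 1) * W.depth := by
  unfold rankBound
  unfold headWindowOf at h ⊢
  rw [List.findSome?_append, h]
  simp

/-! ## The live items -/

/-- A live item: it is stored as node `pos` of sub-queue `sub`, in the window `win`. -/
structure Entry (α : Type*) (N : ℕ) where
  sub : Fin N
  pos : ℕ
  item : α
  win : ℕ

/-- The bounds on row and sub-queue serve the counting of ranks; the recorded `put` serves the claim
that an item is taken in the window in which it was put. -/
def Entry.Valid (g : Shared α N) (tr : List (Action α N)) (e : Entry α N) : Prop :=
  ∃ row W, (g.sub e.sub).nodes[e.pos]? = some ⟨some e.item, row⟩ ∧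
    g.lateral.nodes[e.win]? = some W ∧ W.max - W.depth < row ∧ row ≤ W.max ∧
    (e.sub : ℕ) < W.width ∧ ∃ o, Action.put o e.item e.sub e.pos W ∈ tr

theorem Entry.Valid.mono {g g' : Shared α N} {tr tr' : List (Action α N)} {e : Entry α N}
    (h : e.Valid g tr) (hg : Extends g g') (htr : tr ⊆ tr') : e.Valid g' tr' := by
  obtain ⟨row, W, hnd, hW, h1, h2, h3, o, ho⟩ := h
  exact ⟨row, W, getElem?_of_prefix (hg.sub _) hnd, getElem?_of_prefix hg.lateral hW, h1, h2, h3,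
    o, htr ho⟩

/-- `Q` lists the live items in the order in which they were put. -/
structure Contents (g : Shared α N) (tr : List (Action α N)) (Q : List (Entry α N)) : Prop where
  valid : ∀ e ∈ Q, e.Valid g tr
  head_lt : ∀ e ∈ Q, (g.sub e.sub).head < e.pos
  lateralHead_le : ∀ e ∈ Q, g.lateral.head ≤ e.win
  complete : ∀ j p, (g.sub j).head < p → p < (g.sub j).nodes.length → ∃ e ∈ Q, e.sub = j ∧ e.pos = p
  sorted : Q.Pairwise fun e e' => e.win ≤ e'.win ∧ (e.sub = e'.sub → e.pos < e'.pos)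

/-- The Lateral may grow at its tail: entries refer to windows by position, and only the head
pointer enters the bounds. -/
theorem Contents.of_eq {g g' : Shared α N} {tr : List (Action α N)} {Q : List (Entry α N)}
    (h : Contents g tr Q) (hg : Extends g g') (hsub : g'.sub = g.sub)
    (hlat : g'.lateral.head = g.lateral.head) (a : Action α N) : Contents g' (tr ++ [a]) Q where
  valid e he := (h.valid e he).mono hg (List.subset_append_left _ _)
  head_lt := by rw [hsub]; exact h.head_lt
  lateralHead_le := by rw [hlat]; exact h.lateralHead_le
  complete := by rw [hsub]; exact h.complete
  sorted := h.sorted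

/-- An item in the rows of the head window lives in the head window. -/
theorem Contents.win_eq {g : Shared α N} {tr : List (Action α N)} {Q : List (Entry α N)}
    (h : Contents g tr Q) (hg : SharedInv g) {e : Entry α N} (he : e ∈ Q) {W : Window}
    {nd : Node α} (hW : g.HeadWindow W) (hnd : (g.sub e.sub).nodes[e.pos]? = some nd)
    (hle : nd.row ≤ W.max) : e.win = g.lateral.head := by
  obtain ⟨row, V, hnd', hV, hlt, -⟩ := h.valid e he
  rw [hnd] at hnd'
  obtain rfl := Option.some.inj hnd'
  by_contra hne
  have := h.lateralHead_le e he
  have := rel_of_pairwise hg.windows hW hV (by omega)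
  simp only at hle
  omega

/-- The rank of the first item of a sub-queue, if it lies in the head window. -/
theorem Contents.rank_le {g : Shared α N} {tr : List (Action α N)} {Q : List (Entry α N)}
    (h : Contents g tr Q) (hg : SharedInv g) {n : ℕ} {e : Entry α N} (hn : Q[n]? = some e)
    {W : Window} (hW : g.HeadWindow W) (hpos : e.pos = (g.sub e.sub).head + 1)
    (hwin : e.win = g.lateral.head) : n ≤ (W.width - 1) * W.depth := by
  obtain ⟨hlt, hne⟩ := List.getElem?_eq_some_iff.mp hn
  -- Windows are nondecreasing along `Q`, so earlier items are squeezed into the head window; one in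
  -- the same sub-queue would sit strictly between the head and its successor.
  have hbefore : ∀ a ∈ Q.take n, a ∈ Q ∧ a.win = g.lateral.head ∧ a.sub ≠ e.sub := by
    intro a ha
    have haQ := List.mem_of_mem_take ha
    obtain ⟨i, hi⟩ := List.mem_iff_getElem?.mp ha
    have hin := lt_length_of_getElem? hi
    rw [List.length_take] at hin
    rw [List.getElem?_take_of_lt (by omega)] at hi
    obtain ⟨h1, h2⟩ := rel_of_pairwise h.sorted hi hn (by omega)
    have := h.lateralHead_le a haQ
    refine ⟨haQ, by omega, fun hs => ?_⟩
    have h3 := h2 hs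
    have h4 := h.head_lt a haQ
    rw [hs] at h4
    omega
  -- The default `0` never matters: `hrow` shows that the node exists.
  let row (a : Entry α N) : ℕ := ((g.sub a.sub).nodes[a.pos]?).elim 0 Node.row
  have hrow : ∀ a ∈ Q.take n, ∃ nd, (g.sub a.sub).nodes[a.pos]? = some nd ∧ row a = nd.row ∧
      W.max - W.depth < nd.row ∧ nd.row ≤ W.max ∧ (a.sub : ℕ) < W.width := by
    intro a ha
    obtain ⟨haQ, hwin', -⟩ := hbefore a ha
    obtain ⟨r, V, hnd, hV, hr, hr', hw, -⟩ := h.valid a haQ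
    rw [hwin', show g.lateral.nodes[g.lateral.head]? = some W from hW] at hV
    obtain rfl := Option.some.inj hV
    exact ⟨_, hnd, by simp [row, hnd], hr, hr', hw⟩
  let f (a : Entry α N) : ℕ × ℕ := (a.sub, row a)
  -- Items of one sub-queue have different rows, since rows increase with positions.
  have hnodup : ((Q.take n).map f).Nodup := by
    refine List.pairwise_map.mpr ?_
    refine (h.sorted.sublist (List.take_sublist n Q)).imp_of_mem fun {a b} ha hb hab hf => ?_
    obtain ⟨x, hx, hxr, -⟩ := hrow a ha
    obtain ⟨y, hy, hyr, -⟩ := hrow b hb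
    simp only [f, Prod.mk.injEq] at hf
    have hs : a.sub = b.sub := Fin.ext hf.1
    have hlt := hab.2 hs
    rw [hs] at hx
    have := rel_of_pairwise (hg.rows b.sub) hx hy hlt
    omega
  have hsub : ((Q.take n).map f).toFinset ⊆
      (Finset.range W.width).erase e.sub ×ˢ Finset.Ioc (W.max - W.depth) W.max := by
    intro y hy
    obtain ⟨a, ha, rfl⟩ := List.mem_map.mp (List.mem_toFinset.mp hy)
    obtain ⟨nd, -, hr, h1, h2, h3⟩ := hrow a ha
    obtain ⟨-, -, hne'⟩ := hbefore a ha
    simp only [f, Finset.mem_product, Finset.mem_erase, Finset.mem_range, Finset.mem_Ioc, hr]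
    exact ⟨⟨fun heq => hne' (Fin.ext heq), h3⟩, h1, h2⟩
  have hcard := Finset.card_le_card hsub
  have heW : (e.sub : ℕ) < W.width := by
    obtain ⟨r, V, -, hV, -, -, hw, -⟩ := h.valid e (List.mem_of_getElem? hn)
    rw [hwin, show g.lateral.nodes[g.lateral.head]? = some W from hW] at hV
    obtain rfl := Option.some.inj hV
    exact hw
  rw [List.toFinset_card_of_nodup hnodup, List.length_map, List.length_take,
    Finset.card_product, Finset.card_erase_of_mem (Finset.mem_range.mpr heW), Finset.card_range,
    Nat.card_Ioc, min_eq_left hlt.le] at hcard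
  -- With truncated subtraction the window has `W.max - (W.max - W.depth)` rows, which is at most
  -- `W.depth`.
  exact hcard.trans (Nat.mul_le_mul_left _ (by omega))

theorem Contents.put {g : Shared α N} {tr : List (Action α N)} {Q : List (Entry α N)}
    (h : Contents g tr Q) (hg : SharedInv g) {o : ℕ} {x : α} {w : ℕ} {j : Fin N} {last row : ℕ}
    {W : Window} (hl : LocalInv g (.enqTry o x w j last row))
    (hlast : last + 1 = (g.sub j).nodes.length) (hW : g.TailWindow W) :
    Contents
      { g with
        sub := Function.update g.sub j ⟨(g.sub j).nodes ++ [⟨some x, row⟩], (g.sub j).head⟩ }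
      (tr ++ [.put o x j (last + 1) W]) (Q ++ [⟨j, last + 1, x, w⟩]) := by
  have e : Extends g { g with
      sub := Function.update g.sub j ⟨(g.sub j).nodes ++ [⟨some x, row⟩], (g.sub j).head⟩ } :=
    Extends.of_update (List.prefix_append _ _) le_rfl
  have htail := hg.isTail_of_enqTry hl hlast
  obtain ⟨V, nd, hV, hj, hnd, -, -, hlo, hhi⟩ := hl
  -- The window the thread read earlier is still the tail, so it is the one in the label.
  obtain rfl : V = W := by
    rw [Shared.TailWindow, List.getLast?_eq_getElem?, ← htail, Nat.add_sub_cancel, hV] at hW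
    exact Option.some.inj hW
  have hhead : ∀ i, (Function.update g.sub j
      ⟨(g.sub j).nodes ++ [⟨some x, row⟩], (g.sub j).head⟩ i).head = (g.sub i).head := by
    intro i
    by_cases hi : i = j
    · subst hi; simp
    · simp [hi]
  have hhj := hg.head_lt j
  refine ⟨?_, ?_, ?_, ?_, ?_⟩
  · intro a ha
    rcases List.mem_append.mp ha with ha | ha
    · exact (h.valid a ha).mono e (List.subset_append_left _ _)
    · obtain rfl := List.mem_singleton.mp ha
      refine ⟨row, V, ?_, hV, hlo, hhi, hj, o, by simp⟩
      simp only [Function.update_self]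
      rw [hlast, List.getElem?_concat_length]
  · intro a ha
    simp only [hhead]
    rcases List.mem_append.mp ha with ha | ha
    · exact h.head_lt a ha
    · obtain rfl := List.mem_singleton.mp ha
      simp only
      omega
  · intro a ha
    rcases List.mem_append.mp ha with ha | ha
    · exact h.lateralHead_le a ha
    · obtain rfl := List.mem_singleton.mp ha
      have := hg.lateralHead_lt
      simp only
      omega
  · intro i p hp hlt
    simp only [hhead] at hp
    by_cases hi : i = j
    · subst hi
      simp only [Function.update_self, List.length_append, List.length_singleton] at hlt
      rcases (show p ≤ last + 1 by omega).eq_or_lt with rfl | hp'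
      · exact ⟨_, List.mem_append_right _ (List.mem_singleton_self _), rfl, rfl⟩
      · obtain ⟨a, ha, h'⟩ := h.complete i p hp (by omega)
        exact ⟨a, List.mem_append_left _ ha, h'⟩
    · simp only [Function.update_of_ne hi] at hlt
      obtain ⟨a, ha, h'⟩ := h.complete i p hp hlt
      exact ⟨a, List.mem_append_left _ ha, h'⟩
  · refine List.pairwise_append.mpr ⟨h.sorted, List.pairwise_singleton _ _, ?_⟩
    intro a ha b hb
    obtain rfl := List.mem_singleton.mp hb
    obtain ⟨r, A, hr, hA, -⟩ := h.valid a ha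
    have h1 := lt_length_of_getElem? hA
    have h2 := lt_length_of_getElem? hr
    -- The new item lies in the last window and beyond the old end of its sub-queue, so it may be
    -- appended to the order.
    refine ⟨by simp only; omega, fun hs => ?_⟩
    simp only at hs
    rw [hs] at h2
    simp only
    omega

theorem Contents.take {g : Shared α N} {tr : List (Action α N)} {Q : List (Entry α N)}
    (h : Contents g tr Q) {j : Fin N} {n : ℕ} {e : Entry α N}
    (hn : Q[n]? = some e) (hj : e.sub = j) (hpos : e.pos = (g.sub j).head + 1)
    (a : Action α N) :
    Contents { g with sub := Function.update g.sub j ⟨(g.sub j).nodes, (g.sub j).head + 1⟩ }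
      (tr ++ [a]) (Q.eraseIdx n) := by
  have ext : Extends g
      { g with sub := Function.update g.sub j ⟨(g.sub j).nodes, (g.sub j).head + 1⟩ } :=
    Extends.of_update List.prefix_rfl (Nat.le_succ _)
  have hmem : ∀ b ∈ Q.eraseIdx n, b ∈ Q := fun b hb => (List.eraseIdx_sublist Q n).subset hb
  refine ⟨?_, ?_, ?_, ?_, h.sorted.eraseIdx n⟩
  · exact fun b hb => (h.valid b (hmem b hb)).mono ext (List.subset_append_left _ _)
  · intro b hb
    have hb' := h.head_lt b (hmem b hb)
    by_cases hbj : b.sub = j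
    · obtain ⟨i, hi, hin, rfl⟩ := List.mem_eraseIdx_iff_getElem.mp hb
      have hQi : Q[i]? = some Q[i] := List.getElem?_eq_getElem hi
      -- By sortedness no second entry describes the node taken, so the remaining ones of `j` lie
      -- beyond the new head.
      have hne : Q[i].pos ≠ e.pos := by
        rcases Nat.lt_or_gt_of_ne hin with hlt | hlt
        · exact ((rel_of_pairwise h.sorted hQi hn hlt).2 (hbj.trans hj.symm)).ne
        · exact ((rel_of_pairwise h.sorted hn hQi hlt).2 (hj.trans hbj.symm)).ne'
      simp only [hbj, Function.update_self] at hb' ⊢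
      omega
    · simpa only [Function.update_of_ne hbj] using hb'
  · exact fun b hb => h.lateralHead_le b (hmem b hb)
  · intro i p hp hlt
    have hold : (g.sub i).head < p ∧ p < (g.sub i).nodes.length ∧ (i = j → p ≠ e.pos) := by
      by_cases hij : i = j
      · subst hij
        simp only [Function.update_self] at hp hlt
        exact ⟨by omega, hlt, fun _ => by omega⟩
      · simp only [Function.update_of_ne hij] at hp hlt
        exact ⟨hp, hlt, fun hij' => absurd hij' hij⟩
    obtain ⟨b, hb, rfl, rfl⟩ := h.complete i p hold.1 hold.2.1
    obtain ⟨i', hi', rfl⟩ := List.mem_iff_getElem.mp hb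
    refine ⟨_, List.mem_eraseIdx_iff_getElem.mpr ⟨i', hi', ?_, rfl⟩, rfl, rfl⟩
    rintro rfl
    rw [List.getElem?_eq_getElem hi'] at hn
    obtain rfl := Option.some.inj hn
    exact hold.2.2 hj rfl

/-- Live items in a drained sub-queue lie above the maximum of the window, so the window being left
holds none. -/
theorem Contents.shiftHead {g : Shared α N} {tr : List (Action α N)} {Q : List (Entry α N)}
    (h : Contents g tr Q) (hg : SharedInv g) {o : ℕ}
    (hl : LocalInv g (.shiftHead o g.lateral.head)) (a : Action α N) :
    Contents { g with lateral := ⟨g.lateral.nodes, g.lateral.head + 1⟩ } (tr ++ [a]) Q where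
  valid e he := (h.valid e he).mono (Extends.of_lateral List.prefix_rfl (Nat.le_succ _))
    (List.subset_append_left _ _)
  head_lt := h.head_lt
  lateralHead_le e he := by
    obtain ⟨V, hV, hdr⟩ := hl
    obtain ⟨row, W, hnd, hW, -, hle, hw, -⟩ := h.valid e he
    refine (h.lateralHead_le e he).lt_of_ne fun heq => ?_
    rw [← heq, hV] at hW
    obtain rfl := Option.some.inj hW
    exact (hg.lt_row_of_drained (hdr e.sub hw) (h.head_lt e he) hnd).not_ge hle
  complete := h.complete
  sorted := h.sorted

/-! ## Running operations -/

/-- The identifier of the running operation. -/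
def Pc.opId : Pc α N → Option ℕ
  | .idle => none
  | .enqStart o _ | .enqSearch o _ _ _ | .enqTry o _ _ _ _ _ | .shiftTail o _ _
  | .shiftTailWidth o _ _ _ | .shiftTailTry o _ _ _ | .deqStart o | .deqSearch o _ _
  | .deqTry o _ _ _ | .shiftHead o _ | .deqCollect o _ _ _ | .ret o _ => some o

/-- The running operation, unless it is about to return. -/
def Pc.op? : Pc α N → Option (Op α)
  | .idle | .ret _ _ => none
  | .enqStart _ x | .enqSearch _ x _ _ | .enqTry _ x _ _ _ _ | .shiftTail _ x _
  | .shiftTailWidth _ x _ _ | .shiftTailTry _ x _ _ => some (.enq x)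
  | .deqStart _ | .deqSearch _ _ _ | .deqTry _ _ _ _ | .shiftHead _ _
  | .deqCollect _ _ _ _ => some .deq

/-- For the bookkeeping of histories, all steps reduce to three kinds: start with a fresh
identifier, return, or continue the same operation invisibly. -/
theorem ThreadStep.opId_cases {g g' : Shared α N} {c c' : Pc α N} {a : Action α N}
    (h : ThreadStep g c a g' c') :
    (∃ op, a = .inv g.nextOp op ∧ g'.nextOp = g.nextOp + 1 ∧ c'.opId = some g.nextOp ∧
      c'.op? = some op) ∨
    (∃ o r, a = .res o r ∧ g'.nextOp = g.nextOp ∧ c.opId = some o ∧ c' = .idle) ∨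
    (a.event? = none ∧ g'.nextOp = g.nextOp ∧ c'.opId = c.opId ∧
      ∀ op, c'.op? = some op → c.op? = some op) := by
  cases h with
  | invEnq x => exact .inl ⟨_, rfl, rfl, rfl, rfl⟩
  | invDeq => exact .inl ⟨_, rfl, rfl, rfl, rfl⟩
  | response o r => exact .inr (.inl ⟨o, r, rfl, rfl, rfl, rfl⟩)
  | _ => exact .inr (.inr ⟨rfl, rfl, rfl, by simp [Pc.op?]⟩)

/-- Identifiers are fresh and unique, and running operations are pending in the history. -/
structure HistoryInv (H : List (Event α)) (s : State α T N) : Prop where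
  inv_lt : ∀ o op, Event.inv o op ∈ H → o < s.shared.nextOp
  res_lt : ∀ o r, Event.res o r ∈ H → o < s.shared.nextOp
  opId_lt : ∀ t o, (s.pc t).opId = some o → o < s.shared.nextOp
  invoked : ∀ t o op, (s.pc t).opId = some o → (s.pc t).op? = some op → Event.inv o op ∈ H
  pending : ∀ t o, (s.pc t).opId = some o → ∀ r, Event.res o r ∉ H
  unique : ∀ t t' o, (s.pc t).opId = some o → (s.pc t').opId = some o → t = t'

theorem HistoryInv.thread [DecidableEq T] {tr : List (Action α N)} {s : State α T N}
    (h : HistoryInv (history tr) s) {t : T} {a : Action α N} {g' : Shared α N} {c' : Pc α N}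
    (hstep : ThreadStep s.shared (s.pc t) a g' c') :
    HistoryInv (history (tr ++ [a])) ⟨g', Function.update s.pc t c'⟩ := by
  rcases hstep.opId_cases with ⟨op, rfl, hn, hid, hop⟩ | ⟨o, r, rfl, hn, hid, rfl⟩ |
    ⟨ha, hn, hid, hop⟩
  · rw [history_append_of_some (e := .inv s.shared.nextOp op) rfl]
    have hfresh : ∀ t' o, t' ≠ t → (s.pc t').opId = some o → o ≠ s.shared.nextOp :=
      fun t' o _ ho => (h.opId_lt t' o ho).ne
    refine ⟨?_, ?_, ?_, ?_, ?_, ?_⟩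
    · intro o op' ho
      rw [hn]
      rcases List.mem_append.mp ho with ho | ho
      · exact (h.inv_lt o op' ho).trans (Nat.lt_succ_self _)
      · cases List.mem_singleton.mp ho
        exact Nat.lt_succ_self _
    · intro o r ho
      rw [hn]
      exact (h.res_lt o r (by simpa using ho)).trans (Nat.lt_succ_self _)
    · intro t' o ho
      rw [hn]
      by_cases ht : t' = t
      · subst ht
        simp only [Function.update_self, hid, Option.some.injEq] at ho
        omega
      · simp only [Function.update_of_ne ht] at ho
        exact (h.opId_lt t' o ho).trans (Nat.lt_succ_self _)
    · intro t' o op' ho hop'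
      by_cases ht : t' = t
      · subst ht
        simp only [Function.update_self, hid, hop, Option.some.injEq] at ho hop'
        subst ho hop'
        simp
      · simp only [Function.update_of_ne ht] at ho hop'
        exact List.mem_append_left _ (h.invoked t' o op' ho hop')
    · intro t' o ho r hr
      replace hr : Event.res o r ∈ history tr := by simpa using hr
      by_cases ht : t' = t
      · subst ht
        simp only [Function.update_self, hid, Option.some.injEq] at ho
        have := h.res_lt o r hr
        omega
      · simp only [Function.update_of_ne ht] at ho
        exact h.pending t' o ho r hr
    · intro t₁ t₂ o h₁ h₂
      by_cases ht₁ : t₁ = t <;> by_cases ht₂ : t₂ = t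
      · rw [ht₁, ht₂]
      · subst ht₁
        simp only [Function.update_self, Function.update_of_ne ht₂, hid, Option.some.injEq]
          at h₁ h₂
        exact absurd h₁.symm (hfresh t₂ o ht₂ h₂)
      · subst ht₂
        simp only [Function.update_self, Function.update_of_ne ht₁, hid, Option.some.injEq]
          at h₁ h₂
        exact absurd h₂.symm (hfresh t₁ o ht₁ h₁)
      · simp only [Function.update_of_ne ht₁, Function.update_of_ne ht₂] at h₁ h₂
        exact h.unique t₁ t₂ o h₁ h₂
  · rw [history_append_of_some (e := .res o r) rfl]
    have hother : ∀ t' o', (Function.update s.pc t Pc.idle t').opId = some o' →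
        t' ≠ t ∧ (s.pc t').opId = some o' := by
      intro t' o' ho'
      by_cases ht : t' = t
      · subst ht
        simp [Pc.opId] at ho'
      · rw [Function.update_of_ne ht] at ho'
        exact ⟨ht, ho'⟩
    refine ⟨?_, ?_, ?_, ?_, ?_, ?_⟩
    · intro o' op ho'
      rw [hn]
      exact h.inv_lt o' op (by simpa using ho')
    · intro o' r' ho'
      rw [hn]
      rcases List.mem_append.mp ho' with ho' | ho'
      · exact h.res_lt o' r' ho'
      · cases List.mem_singleton.mp ho'
        exact h.opId_lt t o hid
    · intro t' o' ho'
      rw [hn]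
      exact h.opId_lt t' o' (hother t' o' ho').2
    · intro t' o' op ho' hop
      obtain ⟨ht, ho'⟩ := hother t' o' ho'
      simp only [Function.update_of_ne ht] at hop
      exact List.mem_append_left _ (h.invoked t' o' op ho' hop)
    · intro t' o' ho' r' hr'
      obtain ⟨ht, ho'⟩ := hother t' o' ho'
      rcases List.mem_append.mp hr' with hr' | hr'
      · exact h.pending t' o' ho' r' hr'
      · cases List.mem_singleton.mp hr'
        exact ht (h.unique t' t o ho' hid)
    · exact fun t₁ t₂ o' h₁ h₂ => h.unique t₁ t₂ o' (hother t₁ o' h₁).2 (hother t₂ o' h₂).2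
  · rw [history_append_of_none ha]
    have hsame : ∀ t', (Function.update s.pc t c' t').opId = (s.pc t').opId := by
      intro t'
      by_cases ht : t' = t
      · subst ht; simp [hid]
      · simp [ht]
    refine ⟨?_, ?_, ?_, ?_, ?_, ?_⟩
    · rw [hn]; exact h.inv_lt
    · rw [hn]; exact h.res_lt
    · simp only [hsame, hn]; exact h.opId_lt
    · simp only [hsame]
      intro t' o op ho hop'
      by_cases ht : t' = t
      · subst ht
        simp only [Function.update_self] at hop'
        exact h.invoked t' o op ho (hop op hop')
      · simp only [Function.update_of_ne ht] at hop'
        exact h.invoked t' o op ho hop'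
    · simp only [hsame]; exact h.pending
    · simp only [hsame]; exact h.unique

/-! ## The linearization -/

/-- Some sub-queue of the window `w` that has not been collected a second time became or was
nonempty after it was first collected. -/
def Doomed (g : Shared α N) (w : ℕ) (obs : Fin N → Option (ℕ × ℕ)) (same : Finset (Fin N)) :
    Prop :=
  ∃ (W : Window) (j : Fin N) (h r : ℕ), g.lateral.nodes[w]? = some W ∧ (j : ℕ) < W.width ∧ j ∉ same ∧
    obs j = some (h, r) ∧ h + 1 < (g.sub j).nodes.length

/-- How far the running operation has been linearized. An empty dequeue is linearized tentatively at
the start of its second collect, if the queue is empty then, and otherwise it cannot succeed. -/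
def Status (g : Shared α N) (S : List (Call α)) : Pc α N → Prop
  | .idle => True
  | .enqStart o _ | .enqSearch o _ _ _ | .enqTry o _ _ _ _ _ | .shiftTail o _ _
  | .shiftTailWidth o _ _ _ | .shiftTailTry o _ _ _ | .deqStart o | .deqSearch o _ _
  | .deqTry o _ _ _ | .shiftHead o _ => o ∉ S.map Call.id
  | .deqCollect o w obs same => ⟨o, .deq, .empty⟩ ∈ S ∨ o ∉ S.map Call.id ∧ Doomed g w obs same
  | .ret o r => ∃ c ∈ S, c.id = o ∧ c.ret = r

/-- Only calls of the operation in question matter, so another thread may append its call or retract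
a tentative one. -/
theorem Status.mono {g g' : Shared α N} (e : Extends g g') {S S' : List (Call α)} {c : Pc α N}
    (h : Status g S c) (hS : ∀ cl : Call α, c.opId = some cl.id → (cl ∈ S ↔ cl ∈ S')) :
    Status g' S' c := by
  have hnot : ∀ o, c.opId = some o → o ∉ S.map Call.id → o ∉ S'.map Call.id := by
    intro o ho hn hm
    obtain ⟨cl, hcl, rfl⟩ := List.mem_map.mp hm
    exact hn (List.mem_map_of_mem ((hS cl ho).mpr hcl))
  cases c with
  | idle => trivial
  | deqCollect o w obs same =>
    rcases h with h | ⟨h, W, j, p, r, hW, hj, hs, ho, hlt⟩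
    · exact .inl ((hS _ rfl).mp h)
    · exact .inr ⟨hnot o rfl h, W, j, p, r, getElem?_of_prefix e.lateral hW, hj, hs, ho,
        hlt.trans_le (e.sub j).length_le⟩
  | ret o r =>
    obtain ⟨cl, hcl, rfl, hr⟩ := h
    exact ⟨cl, (hS cl rfl).mp hcl, rfl, hr⟩
  | _ => exact hnot _ rfl h

/-- `S` linearizes the trace `tr` and leaves the relaxed queue with the contents `Q`. -/
structure Linearizes (g : Shared α N) (tr : List (Action α N)) (Q : List (Entry α N))
    (S : List (Call α)) : Prop where
  linearization : IsLinearization (history tr) S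
  run : RelaxedRun (rankBound tr) [] S (Q.map Entry.item)
  contents : Contents g tr Q
  take : ∀ o x j p W, Action.take o x j p W ∈ tr →
    ⟨o, .deq, .item x⟩ ∈ S ∧ ∃ o', Action.put o' x j p W ∈ tr

theorem Linearizes.of_eq {g g' : Shared α N} {tr : List (Action α N)} {Q : List (Entry α N)}
    {S : List (Call α)} (h : Linearizes g tr Q S) {a : Action α N} (hg : Extends g g')
    (hsub : g'.sub = g.sub) (hlat : g'.lateral.head = g.lateral.head)
    (hlin : IsLinearization (history (tr ++ [a])) S)
    (ha : ∀ o x j p W, Action.take o x j p W ≠ a) : Linearizes g' (tr ++ [a]) Q S where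
  linearization := hlin
  run := h.run.mono (rankBound_le_append tr [a])
  contents := h.contents.of_eq hg hsub hlat a
  take o x j p W ht := by
    rcases List.mem_append.mp ht with ht | ht
    · obtain ⟨h1, o', ho'⟩ := h.take o x j p W ht
      exact ⟨h1, o', List.mem_append_left _ ho'⟩
    · exact absurd (List.mem_singleton.mp ht) (ha o x j p W)

theorem Linearizes.tau {g g' : Shared α N} {tr : List (Action α N)} {Q : List (Entry α N)}
    {S : List (Call α)} (h : Linearizes g tr Q S) (hg : Extends g g')
    (hsub : g'.sub = g.sub) (hlat : g'.lateral.head = g.lateral.head) :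
    Linearizes g' (tr ++ [.tau]) Q S :=
  h.of_eq hg hsub hlat (by rw [history_append_of_none rfl]; exact h.linearization) (by simp)

theorem Linearizes.put {g : Shared α N} {tr : List (Action α N)} {Q : List (Entry α N)}
    {S : List (Call α)} (h : Linearizes g tr Q S) (hg : SharedInv g) {o : ℕ} {x : α} {w : ℕ}
    {j : Fin N} {last row : ℕ} {W : Window} (hl : LocalInv g (.enqTry o x w j last row))
    (hlast : last + 1 = (g.sub j).nodes.length) (hW : g.TailWindow W)
    (hinv : Event.inv o (.enq x) ∈ history tr) (hres : ∀ r, Event.res o r ∉ history tr)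
    (ho : o ∉ S.map Call.id) :
    Linearizes
      { g with
        sub := Function.update g.sub j ⟨(g.sub j).nodes ++ [⟨some x, row⟩], (g.sub j).head⟩ }
      (tr ++ [.put o x j (last + 1) W]) (Q ++ [⟨j, last + 1, x, w⟩])
      (S ++ [⟨o, .enq x, .ack⟩]) where
  linearization := by
    rw [history_append_of_none rfl]
    exact h.linearization.append_call ho hinv hres
  run := by
    rw [List.map_append, List.map_singleton]
    exact (h.run.mono (rankBound_le_append tr _)).append (.enq _ _ _ _ _ (.nil _))
  contents := h.contents.put hg hl hlast hW
  take o' x' j' p' W' ht := by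
    obtain ⟨h1, o'', h2⟩ := h.take o' x' j' p' W' (by simpa using ht)
    exact ⟨List.mem_append_left _ h1, o'', List.mem_append_left _ h2⟩

theorem Linearizes.take_step {g : Shared α N} {tr : List (Action α N)} {Q : List (Entry α N)}
    {S : List (Call α)} (h : Linearizes g tr Q S) (hg : SharedInv g) {o w : ℕ} {j : Fin N}
    {nd : Node α} {x : α} {W : Window} (hl : LocalInv g (.deqTry o w j (g.sub j).head))
    (hlt : (g.sub j).head + 1 < (g.sub j).nodes.length)
    (hnd : (g.sub j).nodes[(g.sub j).head + 1]? = some nd) (hx : nd.item = some x)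
    (hW : g.HeadWindow W)
    (hinv : Event.inv o .deq ∈ history tr) (hres : ∀ r, Event.res o r ∉ history tr)
    (ho : o ∉ S.map Call.id) :
    ∃ Q', Linearizes
      { g with sub := Function.update g.sub j ⟨(g.sub j).nodes, (g.sub j).head + 1⟩ }
      (tr ++ [.take o x j ((g.sub j).head + 1) W]) Q' (S ++ [⟨o, .deq, .item x⟩]) := by
  have hw := hg.isHead_of_deqTry hl rfl
  obtain ⟨e, he, rfl, hpos⟩ := h.contents.complete j ((g.sub j).head + 1) (Nat.lt_succ_self _) hlt
  obtain ⟨n, hn⟩ := List.mem_iff_getElem?.mp he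
  have hle : nd.row ≤ W.max := by
    obtain ⟨-, V, nd', hV, -, hnd', hle⟩ := hl
    rw [hw, show g.lateral.nodes[g.lateral.head]? = some W from hW] at hV
    rw [hnd] at hnd'
    rwa [← Option.some.inj hnd', ← Option.some.inj hV] at hle
  rw [← hpos] at hnd
  have hwin := h.contents.win_eq hg he hW hnd hle
  obtain ⟨row, V, hnd', hV, -, -, -, o', hput⟩ := h.contents.valid e he
  rw [hnd] at hnd'
  obtain rfl := Option.some.inj hnd'
  obtain rfl : e.item = x := Option.some.inj hx
  rw [hwin, show g.lateral.nodes[g.lateral.head]? = some W from hW] at hV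
  obtain rfl := Option.some.inj hV
  -- An operation that has taken an item is already in `S`, so this is the first take of `o` and
  -- determines its rank bound.
  have hnone : headWindowOf tr o = none := by
    refine List.findSome?_eq_none_iff.mpr fun a ha => ?_
    cases a with
    | take i y k p V =>
      refine if_neg fun hi => ho ?_
      subst hi
      exact List.mem_map_of_mem (f := Call.id) (h.take i y k p V ha).1
    | _ => rfl
  refine ⟨Q.eraseIdx n, ?_, ?_, h.contents.take hn rfl hpos _, ?_⟩
  · rw [history_append_of_none rfl]
    exact h.linearization.append_call ho hinv hres
  · refine (h.run.mono (rankBound_le_append tr _)).append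
      (.deq _ _ _ _ n _ (by simp [hn]) ?_ ?_)
    · rw [rankBound_append_take hnone]
      exact h.contents.rank_le hg hn hW hpos hwin
    · rw [List.eraseIdx_map]
      exact .nil _
  · intro i y k p V ht
    rcases List.mem_append.mp ht with ht | ht
    · obtain ⟨h1, i', h2⟩ := h.take i y k p V ht
      exact ⟨List.mem_append_left _ h1, i', List.mem_append_left _ h2⟩
    · cases List.mem_singleton.mp ht
      exact ⟨by simp, o', List.mem_append_left _ (hpos ▸ hput)⟩

theorem Linearizes.append_empty {g : Shared α N} {tr : List (Action α N)} {S : List (Call α)}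
    (h : Linearizes g tr [] S) {o : ℕ} (hinv : Event.inv o .deq ∈ history tr)
    (hres : ∀ r, Event.res o r ∉ history tr) (ho : o ∉ S.map Call.id) :
    Linearizes g tr [] (S ++ [⟨o, .deq, .empty⟩]) where
  linearization := h.linearization.append_call ho hinv hres
  run := h.run.append (.deqEmpty _ _ _ (.nil _))
  contents := h.contents
  take o' x j p W ht := (h.take o' x j p W ht).imp_left (List.mem_append_left _)

theorem Linearizes.filter_empty {g : Shared α N} {tr : List (Action α N)}
    {Q : List (Entry α N)} {S : List (Call α)} (h : Linearizes g tr Q S) {o : ℕ}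
    (hres : ∀ r, Event.res o r ∉ history tr) (ho : ∀ c ∈ S, c.id = o → c.ret = .empty) :
    Linearizes g tr Q (S.filter fun c => c.id ≠ o) where
  linearization := h.linearization.filter_pending hres
  run := h.run.filter_empty ho
  contents := h.contents
  take o' x j p W ht := by
    obtain ⟨h1, h2⟩ := h.take o' x j p W ht
    refine ⟨List.mem_filter.mpr ⟨h1, ?_⟩, h2⟩
    simp only [ne_eq, decide_eq_true_eq]
    intro heq
    simpa using ho _ h1 heq

/-- If an item is live when a thread starts its second collect, it will not succeed. -/
theorem Contents.doomed {g : Shared α N} {tr : List (Action α N)} {Q : List (Entry α N)}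
    (h : Contents g tr Q) {o w : ℕ} {obs : Fin N → Option (ℕ × ℕ)} {W : Window}
    (hl : LocalInv g (.deqSearch o w obs)) (hW : g.lateral.nodes[w]? = some W)
    (hobs : ∀ j : Fin N, (j : ℕ) < W.width → (obs j).isSome) (hw : g.lateral.IsTail w)
    {e : Entry α N} (he : e ∈ Q) : Doomed g w obs ∅ := by
  obtain ⟨row, V, hnd, hV, -, -, hj, -⟩ := h.valid e he
  have hlt := lt_length_of_getElem? hV
  have hle := h.lateralHead_le e he
  have hwle := hl.1
  unfold MSQueue.IsTail at hw
  -- The chain `w ≤ head ≤ e.win ≤ w` holds: `w` was once the head and is now the last window.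
  rw [show e.win = w by omega, hW] at hV
  obtain rfl := Option.some.inj hV
  obtain ⟨⟨p, r⟩, hpr⟩ := Option.isSome_iff_exists.mp (hobs e.sub hj)
  have hp := (hl.2 e.sub p r hpr).1
  have := h.head_lt e he
  have := lt_length_of_getElem? hnd
  exact ⟨W, e.sub, p, r, hW, hj, Finset.notMem_empty _, hpr, by omega⟩

/-- The last clause says that only calls of the moving operation are added or removed; this
preserves the status of all other threads. -/
theorem Linearizes.step {g g' : Shared α N} {c c' : Pc α N} {a : Action α N}
    {tr : List (Action α N)} {Q : List (Entry α N)} {S : List (Call α)}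
    (h : Linearizes g tr Q S) (hg : SharedInv g) (hl : LocalInv g c) (hs : Status g S c)
    (hfresh : ∀ op, Event.inv g.nextOp op ∉ history tr)
    (hinv : ∀ o op, c.opId = some o → c.op? = some op → Event.inv o op ∈ history tr)
    (hres : ∀ o, c.opId = some o → ∀ r, Event.res o r ∉ history tr)
    (hstep : ThreadStep g c a g' c') :
    ∃ Q' S', Linearizes g' (tr ++ [a]) Q' S' ∧ Status g' S' c' ∧
      ∀ cl : Call α, c.opId ≠ some cl.id → (cl ∈ S ↔ cl ∈ S') := by
  have happ : ∀ (o : ℕ) (c₀ : Call α), c₀.id = o → ∀ cl : Call α, some o ≠ some cl.id →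
      (cl ∈ S ↔ cl ∈ S ++ [c₀]) := by
    rintro o c₀ rfl cl hcl
    simp only [List.mem_append, List.mem_singleton, iff_self_or]
    rintro rfl
    exact absurd rfl hcl
  have ext := hstep.extends
  cases hstep with
  | invEnq x =>
    refine ⟨Q, S, h.of_eq ext rfl rfl ?_ (by simp), ?_, fun _ _ => Iff.rfl⟩
    · rw [history_append_of_some (e := .inv g.nextOp (.enq x)) rfl]
      exact h.linearization.append_inv hfresh
    · intro hm
      obtain ⟨cl, hcl, hid⟩ := List.mem_map.mp hm
      exact hfresh _ (hid ▸ h.linearization.invoked cl hcl)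
  | invDeq =>
    refine ⟨Q, S, h.of_eq ext rfl rfl ?_ (by simp), ?_, fun _ _ => Iff.rfl⟩
    · rw [history_append_of_some (e := .inv g.nextOp .deq) rfl]
      exact h.linearization.append_inv hfresh
    · intro hm
      obtain ⟨cl, hcl, hid⟩ := List.mem_map.mp hm
      exact hfresh _ (hid ▸ h.linearization.invoked cl hcl)
  | response o r =>
    refine ⟨Q, S, h.of_eq ext rfl rfl ?_ (by simp), trivial, fun _ _ => Iff.rfl⟩
    rw [history_append_of_some (e := .res o r) rfl]
    exact h.linearization.append_res hs
  | enqSuccess o x w j last row q W hq hW =>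
    obtain ⟨hlast, rfl⟩ := MSQueue.enqueue?_eq_some hq
    exact ⟨_, _, h.put hg hl hlast hW (hinv o _ rfl rfl) (hres o rfl) hs,
      ⟨_, List.mem_append_right _ (List.mem_singleton_self _), rfl, rfl⟩, happ o _ rfl⟩
  | deqSuccess o w j p q nd x W hq hnd hx hW =>
    obtain ⟨rfl, hlt, rfl⟩ := MSQueue.dequeue?_eq_some hq
    obtain ⟨Q', hQ'⟩ := h.take_step hg hl hlt hnd hx hW (hinv o _ rfl rfl) (hres o rfl) hs
    exact ⟨Q', _, hQ', ⟨_, List.mem_append_right _ (List.mem_singleton_self _), rfl, rfl⟩,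
      happ o _ rfl⟩
  | shiftTailSuccess o x w new L hL =>
    obtain ⟨-, rfl⟩ := MSQueue.enqueue?_eq_some hL
    exact ⟨Q, S, h.tau ext rfl rfl, hs, fun _ _ => Iff.rfl⟩
  | shiftHeadSuccess o w L hL =>
    obtain ⟨rfl, -, rfl⟩ := MSQueue.dequeue?_eq_some hL
    refine ⟨Q, S, ⟨?_, h.run.mono (rankBound_le_append tr _),
      h.contents.shiftHead hg hl _, ?_⟩, hs, fun _ _ => Iff.rfl⟩
    · rw [history_append_of_none rfl]
      exact h.linearization
    · exact (h.tau (Extends.of_eq (g := g) rfl rfl) rfl rfl).take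
  | collect o w obs W hW hobs hw =>
    have h' := h.tau ext rfl rfl
    -- The speculation: if nothing is live, the empty dequeue is linearized now; otherwise any live
    -- item dooms the collect.
    rcases List.eq_nil_or_concat Q with rfl | ⟨Q₀, e, rfl⟩
    · refine ⟨[], _, h'.append_empty (o := o) ?_ ?_ hs,
        .inl (List.mem_append_right _ (List.mem_singleton_self _)), happ o _ rfl⟩
      · rw [history_append_of_none rfl]
        exact hinv o _ rfl rfl
      · rw [history_append_of_none rfl]
        exact hres o rfl
    · exact ⟨_, S, h', .inr ⟨hs, h.contents.doomed hl hW hobs hw (e := e) (by simp)⟩,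
        fun _ _ => Iff.rfl⟩
  | collectSame o w obs same j r hobs hj =>
    refine ⟨Q, S, h.tau ext rfl rfl, ?_, fun _ _ => Iff.rfl⟩
    rcases hs with hs | ⟨hs, W, i, p, r', hW, hi, hsame, hobs', hlt⟩
    · exact .inl hs
    · refine .inr ⟨hs, W, i, p, r', hW, hi, fun hm => ?_, hobs', hlt⟩
      rcases Finset.mem_insert.mp hm with rfl | hm
      · rw [hobs, Option.some.injEq, Prod.mk.injEq] at hobs'
        obtain ⟨rfl, -⟩ := hobs'
        -- The doomed sub-queue cannot be the one just accepted: its recorded dummy has a successor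
        -- and is not the tail.
        exact hlt.ne hj
      · exact hsame hm
  | collectRestart o w obs same =>
    have h' := h.tau ext rfl rfl
    -- The collect is abandoned, so the tentative call, if any, is withdrawn.
    refine ⟨Q, _, h'.filter_empty (o := o) ?_ ?_, ?_, ?_⟩
    · rw [history_append_of_none rfl]
      exact hres o rfl
    · intro cl hcl hid
      rcases hs with hs | ⟨hs, -⟩
      · rw [List.inj_on_of_nodup_map h.linearization.nodup hcl hs hid]
      · exact absurd (hid ▸ List.mem_map_of_mem (f := Call.id) hcl) hs
    · intro hm
      obtain ⟨cl, hcl, hid⟩ := List.mem_map.mp hm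
      simpa [hid] using (List.mem_filter.mp hcl).2
    · intro cl hcl
      have : cl.id ≠ o := fun heq => hcl (by rw [heq]; rfl)
      simp [List.mem_filter, this]
  | collectDone o w obs same W hW hall =>
    refine ⟨Q, S, h.tau ext rfl rfl, ?_, fun _ _ => Iff.rfl⟩
    rcases hs with hs | ⟨-, V, i, p, r', hV, hi, hsame, -⟩
    · exact ⟨_, hs, rfl, rfl⟩
    · rw [hW] at hV
      obtain rfl := Option.some.inj hV
      exact absurd (hall i hi) hsame
  | _ => exact ⟨Q, S, h.tau ext rfl rfl, hs, fun _ _ => Iff.rfl⟩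

/-! ## The invariant of all executions -/

/-- The linearization is quantified inside the invariant and chosen anew after each step, since
tentative empty dequeues may be withdrawn. -/
structure Invariant (tr : List (Action α N)) (s : State α T N) : Prop where
  shared : SharedInv s.shared
  locals : ∀ t, LocalInv s.shared (s.pc t)
  history : HistoryInv (history tr) s
  linearizes : ∃ Q S, Linearizes s.shared tr Q S ∧ ∀ t, Status s.shared S (s.pc t)

theorem Invariant.initial (d w : ℕ) (hd : 1 ≤ d) :
    Invariant [] (initial α T N d w) where
  shared :=
    { rows := fun _ => List.pairwise_singleton _ _
      head_lt := fun _ => Nat.zero_lt_one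
      windows := List.pairwise_singleton _ _
      depth_pos := by simpa [ElasticLaW.initial] using hd
      depthShared_pos := hd
      lateralHead_lt := Nat.zero_lt_one
      full := fun v W hv => by simp [ElasticLaW.initial] at hv
      drained := fun v W hv => absurd hv (Nat.not_lt_zero v) }
  locals _ := trivial
  history := by
    constructor <;> simp [ElasticLaW.history, ElasticLaW.initial, Pc.opId]
  linearizes := by
    refine ⟨[], [], ⟨?_, .nil _, ?_, by simp⟩, fun _ => trivial⟩
    · constructor <;> simp [ElasticLaW.history]
    · refine ⟨by simp, by simp, by simp, fun j p hp hlt => ?_, List.Pairwise.nil⟩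
      simp only [ElasticLaW.initial, List.length_singleton] at hp hlt
      omega

/-- Reconfiguration of the desired depth and width. -/
theorem Invariant.reconfigure {tr : List (Action α N)} {s : State α T N} (h : Invariant tr s)
    {d w : ℕ} (hd : 1 ≤ d) :
    Invariant (tr ++ [.tau])
      { s with shared := { s.shared with depthShared := d, widthShared := w } } where
  shared := h.shared.of_eq rfl rfl hd
  locals t := (h.locals t).mono (Extends.of_eq rfl rfl)
  history := by
    rw [history_append_of_none rfl]
    exact ⟨h.history.inv_lt, h.history.res_lt, h.history.opId_lt, h.history.invoked,
      h.history.pending, h.history.unique⟩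
  linearizes := by
    obtain ⟨Q, S, hlin, hs⟩ := h.linearizes
    exact ⟨Q, S, hlin.tau (Extends.of_eq rfl rfl) rfl rfl,
      fun t => (hs t).mono (Extends.of_eq rfl rfl) fun _ _ => Iff.rfl⟩

theorem Invariant.step [DecidableEq T] {tr : List (Action α N)} {s s' : State α T N}
    {a : Action α N} (h : Invariant tr s) (hstep : Step s a s') : Invariant (tr ++ [a]) s' := by
  cases hstep with
  | thread t _ g' c' hstep =>
    have ext := hstep.extends
    refine ⟨h.shared.step (h.locals t) hstep, fun t' => ?_, h.history.thread hstep, ?_⟩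
    · by_cases ht : t' = t
      · subst ht
        simpa using (h.locals t').step h.shared hstep
      · simpa [ht] using (h.locals t').mono ext
    · obtain ⟨Q, S, hlin, hs⟩ := h.linearizes
      obtain ⟨Q', S', hlin', hs', hS⟩ := hlin.step h.shared (h.locals t) (hs t)
        (fun op hop => (h.history.inv_lt _ op hop).false) (h.history.invoked t)
        (h.history.pending t) hstep
      refine ⟨Q', S', hlin', fun t' => ?_⟩
      by_cases ht : t' = t
      · subst ht
        simpa using hs'
      -- Identifiers of running operations are unique, so the calls that changed do not belong to
      -- `t'`.
      · simpa [ht] using (hs t').mono ext fun cl hcl =>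
          hS cl fun hcl' => ht (h.history.unique t' t cl.id hcl hcl')
  | setDepth d hd => exact h.reconfigure hd
  | setWidth w _ _ => exact h.reconfigure h.shared.depthShared_pos

theorem Invariant.of_execution [DecidableEq T] {d w : ℕ} (hd : 1 ≤ d) {tr : List (Action α N)}
    {s : State α T N} (h : Execution (ElasticLaW.initial α T N d w) tr s) : Invariant tr s := by
  induction h with
  | nil => exact Invariant.initial d w hd
  | snoc tr s a s' _ hstep ih => exact ih.step hstep

end ElasticLaW

theorem theorem1 {α T : Type*} [DecidableEq T] (N d w : ℕ) (hd : 1 ≤ d) (hw : 1 ≤ w) (hwN : w ≤ N)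
    (tr : List (ElasticLaW.Action α N)) (s : ElasticLaW.State α T N)
    (hrun : ElasticLaW.Execution (ElasticLaW.initial α T N d w) tr s) :
    -- the history of the execution is linearizable, with rank error of every non-empty dequeue at
    -- most `(width - 1) * depth` of the head window from which it takes its item
    ElasticLaW.Linearizable (ElasticLaW.history tr) (ElasticLaW.rankBound tr) ∧
    -- and that window is the one in which the item was enqueued
    ∀ (o : ℕ) (x : α) (j : Fin N) (p : ℕ) (W : ElasticLaW.Window),
      ElasticLaW.Action.take o x j p W ∈ tr →
        ∃ o' : ℕ, ElasticLaW.Action.put o' x j p W ∈ tr := by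
  obtain ⟨Q, S, hlin, -⟩ := (ElasticLaW.Invariant.of_execution hd hrun).linearizes
  exact ⟨⟨S, hlin.linearization, hlin.run.relaxedFIFO⟩,
    fun o x j p W ht => (hlin.take o x j p W ht).2⟩
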